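/- Let $\mathfrak{g}=\mathfrak{sl}_2\otimes_{\mathbb{C}}\mathbb{C}[x]/(x^2)$ be the Takiff Lie algebra of $\mathfrak{sl}_2$, with $[a\otimes x^i,b\otimes x^j]=[a,b]\otimes x^{i+j}$. For the standard basis $e,h,f$ of $\mathfrak{sl}_2$ write $a=a\otimes 1$ and $\overline{a}=a\otimes x$; let $\overline{\mathfrak{h}}=\langle h,\overline{h}\rangle$, let $\overline{\mathfrak{b}}=\langle h,\overline{h},e,\overline{e}\rangle$, and let $\alpha\in\overline{\mathfrak{h}}^*$ be given by $\alpha(h)=2$, $\alpha(\overline{h})=0$. Let $\widetilde{\mathcal{O}}$ be the category of finitely generated $\mathfrak{g}$-modules on which $U(\overline{\mathfrak{b}})$ acts locally finitely, and $\mathcal{O}$ its full subcategory of modules on which $h$ acts diagonalizably. The support of a module $M$ is the set of those $\mu\in\overline{\mathfrak{h}}^*$ for which there is a non-zero vector in $M$ killed by a power of $h-\mu(h)$ and by a power of $\overline{h}-\mu(\overline{h})$. For $\lambda\in\overline{\mathfrak{h}}^*$ with $\lambda(\overline{h})\neq 0$ and $\mathcal{X}\in\{\mathcal{O},\widetilde{\mathcal{O}}\}$,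 let $\mathcal{X}(\lambda)$ be the block of $\mathcal{X}$ that consists of all $M\in\mathcal{X}$ such that every simple subquotient of $M$ has support $\{\lambda-n\alpha : n\in\mathbb{Z}_{\geq 0}\}$. The Gabriel quiver of a block has as vertices the isomorphism classes of simple objects of the block, and the number of arrows from $L$ to $S$ is $\dim_{\mathbb{C}}\mathrm{Ext}^1(L,S)$, computed in the block. Then, for every $\lambda\in\overline{\mathfrak{h}}^*$ with $\lambda(\overline{h})\neq 0$: (a) the Gabriel quiver of $\mathcal{O}(\lambda)$ has exactly one vertex and exactly one arrow, a loop; (b) the Gabriel quiver of $\widetilde{\mathcal{O}}(\lambda)$ has exactly one vertex and exactly two arrows, both loops. -/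

import Mathlib

open scoped TensorProduct
namespace PBW

section

attribute [local instance 100] LieRing.ofAssociativeRing

variable {L : Type} [LieRing L] [LieAlgebra ℂ L] {d : ℕ} (x : Fin d → L)

/-- Product in the enveloping algebra of a word in the given elements. -/
noncomputable def word (l : List (Fin d)) : UniversalEnvelopingAlgebra ℂ L :=
  (l.map fun i => UniversalEnvelopingAlgebra.ι ℂ (x i)).prod

/-- The span of the words of length less than `n`. -/
noncomputable def filt (n : ℕ) : Submodule ℂ (UniversalEnvelopingAlgebra ℂ L) :=
  Submodule.span ℂ {u | ∃ l : List (Fin d), l.length < n ∧ word x l = u}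

lemma word_mem {l : List (Fin d)} {n : ℕ} (h : l.length < n) : word x l ∈ filt x n :=
  Submodule.subset_span ⟨l, h, rfl⟩

lemma filt_mono {m n : ℕ} (h : m ≤ n) : filt x m ≤ filt x n :=
  Submodule.span_mono fun _ ⟨l, hl, e⟩ => ⟨l, by omega, e⟩

lemma filt_zero : filt x 0 = ⊥ := by simp [filt]

lemma ι_mul_mem (i : Fin d) {n : ℕ} {u} (hu : u ∈ filt x n) :
    UniversalEnvelopingAlgebra.ι ℂ (x i) * u ∈ filt x (n + 1) := by
  induction hu using Submodule.span_induction with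
  | mem u h =>
    obtain ⟨l, hl, rfl⟩ := h
    have : UniversalEnvelopingAlgebra.ι ℂ (x i) * word x l = word x (i :: l) := by simp [word]
    rw [this]
    exact word_mem x (by simpa using hl)
  | zero => simp
  | add a b _ _ ha hb => rw [mul_add]; exact add_mem ha hb
  | smul c a _ ha => rw [mul_smul_comm]; exact Submodule.smul_mem _ _ ha

lemma ι_mul_mem' (hx : Submodule.span ℂ (Set.range x) = ⊤) (y : L) {n : ℕ} {u}
    (hu : u ∈ filt x n) : UniversalEnvelopingAlgebra.ι ℂ y * u ∈ filt x (n + 1) := by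
  have hy : y ∈ Submodule.span ℂ (Set.range x) := hx ▸ Submodule.mem_top
  induction hy using Submodule.span_induction with
  | mem y h => obtain ⟨i, rfl⟩ := h; exact ι_mul_mem x i hu
  | zero => simp
  | add a b _ _ ha hb => rw [map_add, add_mul]; exact add_mem ha hb
  | smul c a _ ha => rw [map_smul, smul_mul_assoc]; exact Submodule.smul_mem _ _ ha

lemma perm_mem (hx : Submodule.span ℂ (Set.range x) = ⊤) {l₁ l₂ : List (Fin d)}
    (h : l₁.Perm l₂) : word x l₁ - word x l₂ ∈ filt x l₁.length := by
  induction h with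
  | nil => simp
  | cons a h ih =>
    have := ι_mul_mem x a ih
    simpa [word, mul_sub] using this
  | swap a b l =>
    have : word x (b :: a :: l) - word x (a :: b :: l) =
        UniversalEnvelopingAlgebra.ι ℂ ⁅x b, x a⁆ * word x l := by
      simp [word, LieHom.map_lie, LieRing.of_associative_ring_bracket, sub_mul, mul_assoc]
    rw [this]
    exact ι_mul_mem' x hx _ (word_mem x (by simp))
  | trans h₁ h₂ ih₁ ih₂ =>
    rw [← sub_add_sub_cancel]
    exact add_mem ih₁ (h₁.length_eq ▸ ih₂)

lemma exists_mem_filt (hx : Submodule.span ℂ (Set.range x) = ⊤)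
    (u : UniversalEnvelopingAlgebra ℂ L) : ∃ n, u ∈ filt x n := by
  let S : Submodule ℂ (UniversalEnvelopingAlgebra ℂ L) := ⨆ n, filt x n
  have hS : ∀ v, v ∈ S ↔ ∃ n, v ∈ filt x n := fun v =>
    Submodule.mem_iSup_of_directed _ (Monotone.directed_le fun _ _ h => filt_mono x h)
  have key : ∀ w : UniversalEnvelopingAlgebra ℂ L, ∀ v ∈ S, w * v ∈ S := by
    let A : Subalgebra ℂ (UniversalEnvelopingAlgebra ℂ L) :=
      { carrier := {w | ∀ v ∈ S, w * v ∈ S}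
        mul_mem' := fun {a b} ha hb v hv => by rw [mul_assoc]; exact ha _ (hb _ hv)
        add_mem' := fun {a b} ha hb v hv => by rw [add_mul]; exact add_mem (ha _ hv) (hb _ hv)
        algebraMap_mem' := fun r v hv => by
          rw [← Algebra.smul_def]; exact Submodule.smul_mem _ _ hv }
    have hι : ∀ y : L, UniversalEnvelopingAlgebra.ι ℂ y ∈ A := fun y v hv => by
      obtain ⟨n, hn⟩ := (hS v).1 hv
      exact (hS _).2 ⟨_, ι_mul_mem' x hx y hn⟩
    let f : L →ₗ⁅ℂ⁆ A :=
      { toFun := fun y => ⟨UniversalEnvelopingAlgebra.ι ℂ y, hι y⟩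
        map_add' := fun a b => by ext; simp
        map_smul' := fun a b => by ext; simp
        map_lie' := fun {a b} => by
          ext
          simp [LieRing.of_associative_ring_bracket] }
    have e : A.val.comp (UniversalEnvelopingAlgebra.lift ℂ f) = AlgHom.id ℂ _ := by
      ext y
      simp [f]
    intro w
    have := congrArg (fun g : _ →ₐ[ℂ] _ => g w) e
    simp only [AlgHom.comp_apply, AlgHom.id_apply] at this
    rw [← this]
    exact (UniversalEnvelopingAlgebra.lift ℂ f w).2
  have h1 : (1 : UniversalEnvelopingAlgebra ℂ L) ∈ S :=
    (hS _).2 ⟨1, by simpa [word] using word_mem x (l := []) (n := 1) (by simp)⟩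
  simpa using (hS _).1 (key u 1 h1)

open MvPolynomial in
/-- The linear map sending each commutative monomial to an ordered product. -/
noncomputable def lin : MvPolynomial (Fin d) ℂ →ₗ[ℂ] UniversalEnvelopingAlgebra ℂ L :=
  (basisMonomials (Fin d) ℂ).constr ℂ fun a => word x (Finsupp.toMultiset a).toList

open MvPolynomial

lemma lin_monomial (a : Fin d →₀ ℕ) :
    lin x (monomial a 1) = word x (Finsupp.toMultiset a).toList := by
  have := (basisMonomials (Fin d) ℂ).constr_basis ℂ
    (fun a => word x (Finsupp.toMultiset a).toList) a
  simpa [lin] using this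

lemma homog_eq (n : ℕ) : homogeneousSubmodule (Fin d) ℂ n =
    Submodule.span ℂ {p | ∃ a : Fin d →₀ ℕ, a.degree = n ∧ monomial a 1 = p} := by
  apply le_antisymm
  · intro p hp
    rw [← p.support_sum_monomial_coeff]
    refine Submodule.sum_mem _ fun a ha => ?_
    have : monomial a (coeff a p) = coeff a p • monomial a (1 : ℂ) := by simp [smul_monomial]
    rw [this]
    refine Submodule.smul_mem _ _ (Submodule.subset_span ⟨a, ?_, rfl⟩)
    have h := hp (mem_support_iff.1 ha)
    rw [Finsupp.degree_eq_weight_one]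
    exact h
  · rw [Submodule.span_le]
    rintro _ ⟨a, ha, rfl⟩
    exact isHomogeneous_monomial 1 ha

lemma length_toList (a : Fin d →₀ ℕ) : (Finsupp.toMultiset a).toList.length = a.degree := by
  rw [Multiset.length_toList, Finsupp.card_toMultiset]
  rfl

lemma lin_X_mul (hx : Submodule.span ℂ (Set.range x) = ⊤) {n : ℕ} {p : MvPolynomial (Fin d) ℂ}
    (hp : p.IsHomogeneous n) (i : Fin d) :
    lin x (X i * p) - UniversalEnvelopingAlgebra.ι ℂ (x i) * lin x p ∈ filt x (n + 1) := by
  have hp' : p ∈ homogeneousSubmodule (Fin d) ℂ n := hp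
  rw [homog_eq] at hp'
  clear hp
  induction hp' using Submodule.span_induction with
  | mem p h =>
    obtain ⟨a, ha, rfl⟩ := h
    have e : X i * monomial a (1 : ℂ) = monomial (Finsupp.single i 1 + a) 1 := by
      rw [X, monomial_mul, one_mul]
    rw [e, lin_monomial, lin_monomial]
    have e2 : UniversalEnvelopingAlgebra.ι ℂ (x i) * word x (Finsupp.toMultiset a).toList
        = word x (i :: (Finsupp.toMultiset a).toList) := by simp [word]
    rw [e2]
    have hperm : (Finsupp.toMultiset (Finsupp.single i 1 + a)).toList.Perm
        (i :: (Finsupp.toMultiset a).toList) := by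
      rw [← Multiset.coe_eq_coe, ← Multiset.cons_coe]
      simp [Multiset.singleton_add]
    have := perm_mem x hx hperm
    rwa [hperm.length_eq, List.length_cons, length_toList, ha] at this
  | zero => simp
  | add a b _ _ ha hb =>
    have := add_mem ha hb
    simp only [mul_add, map_add] at this ⊢
    convert this using 1
    abel
  | smul c a _ ha =>
    have := Submodule.smul_mem _ c ha
    simpa only [mul_smul_comm, map_smul, smul_sub] using this

lemma exists_lin (hx : Submodule.span ℂ (Set.range x) = ⊤) {n : ℕ} {u}
    (hu : u ∈ filt x (n + 1)) :
    ∃ p : MvPolynomial (Fin d) ℂ, p.IsHomogeneous n ∧ u - lin x p ∈ filt x n := by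
  induction hu using Submodule.span_induction with
  | mem u h =>
    obtain ⟨l, hl, rfl⟩ := h
    rcases Nat.lt_succ_iff_lt_or_eq.1 hl with hl | hl
    · exact ⟨0, isHomogeneous_zero _ _ _, by simpa using word_mem x hl⟩
    · have hperm : l.Perm (Finsupp.toMultiset (Multiset.toFinsupp (l : Multiset (Fin d)))).toList := by
        rw [← Multiset.coe_eq_coe]; simp
      refine ⟨monomial (Multiset.toFinsupp (l : Multiset (Fin d))) 1, isHomogeneous_monomial 1 ?_, ?_⟩
      · rw [← length_toList, ← hperm.length_eq, hl]
      · rw [lin_monomial]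
        exact hl ▸ perm_mem x hx hperm
  | zero => exact ⟨0, isHomogeneous_zero _ _ _, by simp⟩
  | add a b _ _ ha hb =>
    obtain ⟨p, hp, hp'⟩ := ha
    obtain ⟨q, hq, hq'⟩ := hb
    refine ⟨p + q, hp.add hq, ?_⟩
    have := add_mem hp' hq'
    rw [map_add]
    convert this using 1
    abel
  | smul c a _ ha =>
    obtain ⟨p, hp, hp'⟩ := ha
    refine ⟨c • p, (homogeneousSubmodule (Fin d) ℂ n).smul_mem c hp, ?_⟩
    rw [map_smul, ← smul_sub]
    exact Submodule.smul_mem _ _ hp'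

/-- The ideal of leading forms of a left ideal. -/
noncomputable def sym (I : Submodule (UniversalEnvelopingAlgebra ℂ L) (UniversalEnvelopingAlgebra ℂ L)) :
    Ideal (MvPolynomial (Fin d) ℂ) :=
  Ideal.span {p | ∃ n, p.IsHomogeneous n ∧ ∃ u ∈ I, u - lin x p ∈ filt x n}

/-- Leading forms of degree `n` of elements of a left ideal. -/
def IsLead (I : Submodule (UniversalEnvelopingAlgebra ℂ L) (UniversalEnvelopingAlgebra ℂ L))
    (n : ℕ) (p : MvPolynomial (Fin d) ℂ) : Prop :=
  p.IsHomogeneous n ∧ ∃ u ∈ I, u - lin x p ∈ filt x n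

variable (I : Submodule (UniversalEnvelopingAlgebra ℂ L) (UniversalEnvelopingAlgebra ℂ L))

lemma IsLead.zero (n : ℕ) : IsLead x I n 0 :=
  ⟨isHomogeneous_zero _ _ _, 0, zero_mem _, by simp⟩

lemma IsLead.add {n : ℕ} {p q} (hp : IsLead x I n p) (hq : IsLead x I n q) :
    IsLead x I n (p + q) := by
  obtain ⟨h1, u, hu, h2⟩ := hp
  obtain ⟨h3, v, hv, h4⟩ := hq
  refine ⟨h1.add h3, u + v, add_mem hu hv, ?_⟩
  have := add_mem h2 h4
  rw [map_add]
  convert this using 1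
  abel

lemma IsLead.smul {n : ℕ} {p} (c : ℂ) (hp : IsLead x I n p) : IsLead x I n (c • p) := by
  obtain ⟨h1, u, hu, h2⟩ := hp
  refine ⟨(homogeneousSubmodule (Fin d) ℂ n).smul_mem c h1,
    (algebraMap ℂ (UniversalEnvelopingAlgebra ℂ L) c) • u, Submodule.smul_mem _ _ hu, ?_⟩
  have := Submodule.smul_mem _ c h2
  rw [smul_sub, ← map_smul] at this
  rwa [smul_eq_mul, ← Algebra.smul_def]

lemma IsLead.X_mul (hx : Submodule.span ℂ (Set.range x) = ⊤) {n : ℕ} {p} (i : Fin d)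
    (hp : IsLead x I n p) : IsLead x I (n + 1) (X i * p) := by
  obtain ⟨h1, u, hu, h2⟩ := hp
  refine ⟨by simpa [add_comm] using (isHomogeneous_X ℂ i).mul h1,
    UniversalEnvelopingAlgebra.ι ℂ (x i) • u, Submodule.smul_mem _ _ hu, ?_⟩
  have := sub_mem (ι_mul_mem x i h2) (lin_X_mul x hx h1 i)
  rw [smul_eq_mul]
  convert this using 1
  rw [mul_sub]
  abel

lemma sym_lead (hx : Submodule.span ℂ (Set.range x) = ⊤) {p} (hp : p ∈ sym x I) (n : ℕ) :
    IsLead x I n (homogeneousComponent n p) := by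
  let J : Ideal (MvPolynomial (Fin d) ℂ) :=
    { carrier := {p | ∀ n, IsLead x I n (homogeneousComponent n p)}
      add_mem' := fun {a b} ha hb n => by rw [map_add]; exact (ha n).add x I (hb n)
      zero_mem' := fun n => by rw [map_zero]; exact IsLead.zero x I n
      smul_mem' := fun c p hp => by
        simp only [smul_eq_mul, Set.mem_ofPred_eq] at hp ⊢
        induction c using MvPolynomial.induction_on with
        | C a =>
          intro n
          rw [← smul_eq_C_mul, map_smul]
          exact (hp n).smul x I a
        | add a b ha hb =>
          intro n
          rw [add_mul, map_add]
          exact (ha n).add x I (hb n)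
        | mul_X a i ha =>
          intro n
          rw [mul_comm a, mul_assoc]
          cases n with
          | zero =>
            have : homogeneousComponent 0 (X i * (a * p)) = 0 := by
              rw [homogeneousComponent_zero, coeff_X_mul', if_neg (by simp), C_0]
            rw [this]
            exact IsLead.zero x I 0
          | succ n =>
            have : homogeneousComponent (n + 1) (X i * (a * p)) =
                X i * homogeneousComponent n (a * p) := by
              ext b
              rw [coeff_homogeneousComponent, coeff_X_mul', coeff_X_mul',
                coeff_homogeneousComponent]
              by_cases hb : i ∈ b.support
              · have hb' : Finsupp.single i 1 ≤ b := by
                  rw [Finsupp.single_le_iff]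
                  exact Nat.one_le_iff_ne_zero.2 (Finsupp.mem_support_iff.1 hb)
                have hd : (b - Finsupp.single i 1).degree + 1 = b.degree := by
                  conv_rhs => rw [← tsub_add_cancel_of_le hb']
                  rw [map_add, Finsupp.degree_single]
                simp only [hb, if_true]
                congr 1
                simp only [eq_iff_iff]
                omega
              · simp [hb]
            rw [this]
            exact (ha n).X_mul x I hx i }
  have hle : sym x I ≤ J := by
    rw [sym, Ideal.span_le]
    rintro p ⟨m, hm⟩ n
    by_cases h : m = n
    · subst h
      rw [homogeneousComponent_of_mem hm.1, if_pos rfl]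
      exact hm
    · rw [homogeneousComponent_of_mem hm.1, if_neg (Ne.symm h)]
      exact IsLead.zero x I n
  exact hle hp n

lemma eq_of_sym_eq (hx : Submodule.span ℂ (Set.range x) = ⊤)
    {I I' : Submodule (UniversalEnvelopingAlgebra ℂ L) (UniversalEnvelopingAlgebra ℂ L)}
    (hle : I ≤ I') (h : sym x I' ≤ sym x I) : I' ≤ I := by
  have : ∀ n, ∀ u ∈ I', u ∈ filt x n → u ∈ I := by
    intro n
    induction n with
    | zero =>
      intro u _ hu
      rw [filt_zero, Submodule.mem_bot] at hu
      rw [hu]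
      exact zero_mem _
    | succ n ih =>
      intro u hu hun
      obtain ⟨p, hp, hup⟩ := exists_lin x hx hun
      have h1 : p ∈ sym x I' := Ideal.subset_span ⟨n, hp, u, hu, hup⟩
      obtain ⟨-, v, hv, hvp⟩ := sym_lead x I hx (h h1) n
      rw [homogeneousComponent_of_mem hp, if_pos rfl] at hvp
      have h2 : u - v ∈ I := ih _ (sub_mem hu (hle hv)) (by
        have := sub_mem hup hvp
        rwa [sub_sub_sub_cancel_right] at this)
      simpa using add_mem h2 hv
  intro u hu
  obtain ⟨n, hn⟩ := exists_mem_filt x hx u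
  exact this n u hu hn

/-- The enveloping algebra of a finite dimensional Lie algebra is left noetherian. -/
theorem isNoetherianRing [Module.Finite ℂ L] :
    IsNoetherianRing (UniversalEnvelopingAlgebra ℂ L) := by
  let b := Module.finBasis ℂ L
  have hx := b.span_eq
  rw [isNoetherianRing_iff, isNoetherian_iff']
  have hm : StrictMono (sym (b : Fin (Module.finrank ℂ L) → L)) := by
    intro I I' h
    refine lt_of_le_of_ne (Ideal.span_mono ?_) fun e => h.not_ge (eq_of_sym_eq b hx h.le e.ge)
    rintro p ⟨n, hp, u, hu, h'⟩
    exact ⟨n, hp, u, h.le hu, h'⟩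
  exact hm.wellFoundedGT

end

end PBW

open CategoryTheory Limits
open scoped TensorProduct ModuleCat.Algebra

/-! ### The Takiff Lie algebra -/

/-- The Takiff Lie algebra of `sl₂`: the extension of scalars of `sl₂` to the dual numbers,
with bracket `⁅s ⊗ a, t ⊗ b⁆ = (s * t) ⊗ ⁅a, b⁆`. -/
abbrev Takiff : Type := DualNumber ℂ ⊗[ℂ] LieAlgebra.SpecialLinear.sl (Fin 2) ℂ

namespace Takiff

/-- The standard basis of `sl₂`. -/
noncomputable def slE : LieAlgebra.SpecialLinear.sl (Fin 2) ℂ :=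
  LieAlgebra.SpecialLinear.single 0 1 (by decide) 1

noncomputable def slF : LieAlgebra.SpecialLinear.sl (Fin 2) ℂ :=
  LieAlgebra.SpecialLinear.single 1 0 (by decide) 1

noncomputable def slH : LieAlgebra.SpecialLinear.sl (Fin 2) ℂ :=
  LieAlgebra.SpecialLinear.singleSubSingle 0 1 1

noncomputable def e : Takiff := 1 ⊗ₜ slE
noncomputable def f : Takiff := 1 ⊗ₜ slF
noncomputable def h : Takiff := 1 ⊗ₜ slH
noncomputable def eBar : Takiff := DualNumber.eps ⊗ₜ slE
noncomputable def fBar : Takiff := DualNumber.eps ⊗ₜ slF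
noncomputable def hBar : Takiff := DualNumber.eps ⊗ₜ slH

/-- The Cartan subalgebra, generated by `h` and `hBar`. -/
noncomputable def cartan : LieSubalgebra ℂ Takiff := LieSubalgebra.lieSpan ℂ Takiff {h, hBar}

/-- The Borel subalgebra, generated by the Cartan subalgebra and `e`, `eBar`. -/
noncomputable def borel : LieSubalgebra ℂ Takiff :=
  LieSubalgebra.lieSpan ℂ Takiff {h, hBar, e, eBar}

noncomputable def cartanH : cartan := ⟨h, LieSubalgebra.subset_lieSpan (by simp)⟩
noncomputable def cartanHBar : cartan := ⟨hBar, LieSubalgebra.subset_lieSpan (by simp)⟩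

/-- Weights: linear functionals on the Cartan subalgebra. -/
abbrev Weight : Type := Module.Dual ℂ cartan

section

attribute [local instance 100] LieRing.ofAssociativeRing LieAlgebra.ofAssociativeAlgebra

/-- The functional on the whole algebra with `(s + t ε) ⊗ a ↦ 2 * s * a₀₀`. -/
noncomputable def rootAux : Takiff →ₗ[ℂ] ℂ :=
  TensorProduct.lift
    ((LinearMap.mul ℂ ℂ).compl₁₂ (TrivSqZeroExt.fstHom ℂ ℂ ℂ).toLinearMap
      ((2 : ℂ) • (Matrix.entryLinearMap ℂ ℂ (0 : Fin 2) (0 : Fin 2)).comp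
        (LieAlgebra.SpecialLinear.sl (Fin 2) ℂ).toSubmodule.subtype))

instance : Module.Finite ℂ (LieAlgebra.SpecialLinear.sl (Fin 2) ℂ) :=
  inferInstanceAs (Module.Finite ℂ (LinearMap.ker (Matrix.traceLinearMap (Fin 2) ℂ ℂ)))

instance : Module.Finite ℂ Takiff :=
  have : Module.Finite ℂ (DualNumber ℂ) := inferInstanceAs (Module.Finite ℂ (ℂ × ℂ))
  Module.Finite.tensorProduct ℂ _ _

end

/-- The weight `α` with `α(h) = 2` and `α(hBar) = 0`. -/
noncomputable def root : Weight := rootAux.comp cartan.toSubmodule.subtype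

lemma root_cartanH : root cartanH = 2 := by
  change rootAux h = 2
  simp only [rootAux, h, TensorProduct.lift.tmul]
  change (1 : ℂ) * (2 * slH.val 0 0) = 2
  simp [slH]

lemma root_cartanHBar : root cartanHBar = 0 := by
  change rootAux hBar = 0
  simp [rootAux, hBar]

/-! ### Modules -/

/-- The universal enveloping algebra; its modules are the modules over the Lie algebra. -/
abbrev U : Type := UniversalEnvelopingAlgebra ℂ Takiff

instance : IsNoetherianRing U := PBW.isNoetherianRing

/-- The action of an element of the Lie algebra on a module. -/
noncomputable def act (M : ModuleCat.{0} U) (x : Takiff) : Module.End ℂ M :=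
  Algebra.lsmul ℂ ℂ M (UniversalEnvelopingAlgebra.ι ℂ x)

@[simp] lemma act_apply (M : ModuleCat.{0} U) (x : Takiff) (v : M) :
    act M x v = UniversalEnvelopingAlgebra.ι ℂ x • v := rfl

/-- The generalized weight space `M^μ`: the vectors killed by some power of `h - μ(h)` and by
some power of `hBar - μ(hBar)`. -/
noncomputable def weightSpace (M : ModuleCat.{0} U) (μ : Weight) : Submodule ℂ M :=
  (act M h).maxGenEigenspace (μ cartanH) ⊓ (act M hBar).maxGenEigenspace (μ cartanHBar)

/-- The support of a module. -/
def support (M : ModuleCat.{0} U) : Set Weight := {μ | weightSpace M μ ≠ ⊥}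

/-- The enveloping algebra of the Borel subalgebra acts locally finitely: every vector lies in
a finite dimensional subspace stable under the Borel subalgebra. -/
def BorelLocallyFinite (M : ModuleCat.{0} U) : Prop :=
  ∀ v : M, ∃ W : Submodule ℂ M, Module.Finite ℂ W ∧ v ∈ W ∧
    ∀ x ∈ borel, ∀ w ∈ W, act M x w ∈ W

/-- Thick category `O`: finitely generated modules on which the enveloping algebra of the Borel
subalgebra acts locally finitely. -/
def thickO : ObjectProperty (ModuleCat.{0} U) := fun M =>
  Module.Finite U M ∧ BorelLocallyFinite M

/-- Classical category `O`: the modules in thick category `O` on which `h` acts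
diagonalizably. -/
def catO : ObjectProperty (ModuleCat.{0} U) := fun M =>
  thickO M ∧ ⨆ c : ℂ, (act M h).eigenspace c = ⊤

/-- `S` is a subquotient of `M`, that is, a quotient of a submodule. -/
def IsSubquotient (S M : ModuleCat.{0} U) : Prop :=
  ∃ (N : Submodule U M) (p : N →ₗ[U] S), Function.Surjective p

/-- The block of the category `X` attached to a weight `μ` with `μ(hBar) ≠ 0`: the modules in `X`
all of whose simple subquotients have support `{μ - n α : n = 0, 1, 2, …}`. -/
def block (X : ObjectProperty (ModuleCat.{0} U)) (μ : Weight) :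
    ObjectProperty (ModuleCat.{0} U) := fun M =>
  X M ∧ ∀ S : ModuleCat.{0} U, IsSubquotient S M → Simple S →
    support S = {ν | ∃ n : ℕ, ν = μ - n • root}

/-! ### The blocks are abelian categories -/

lemma BorelLocallyFinite.of_injective {M N : ModuleCat.{0} U} (g : M →ₗ[U] N)
    (hg : Function.Injective g) (hN : BorelLocallyFinite N) : BorelLocallyFinite M := fun v => by
  obtain ⟨W, hW, hv, hs⟩ := hN (g v)
  let g' : M →ₗ[ℂ] N := g.restrictScalars ℂ
  refine ⟨W.comap g', ?_, hv, fun x hx w hw => ?_⟩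
  · exact Module.Finite.of_injective (g'.restrict (p := W.comap g') (q := W) fun _ h => h)
      fun a b h => Subtype.ext (hg (congrArg Subtype.val h))
  · have := hs x hx (g w) hw
    rw [act_apply, ← map_smul] at this
    exact this

lemma BorelLocallyFinite.of_surjective {M N : ModuleCat.{0} U} (g : M →ₗ[U] N)
    (hg : Function.Surjective g) (hM : BorelLocallyFinite M) : BorelLocallyFinite N := fun v => by
  obtain ⟨v, rfl⟩ := hg v
  obtain ⟨W, hW, hv, hs⟩ := hM v
  let g' : M →ₗ[ℂ] N := g.restrictScalars ℂ
  refine ⟨W.map g', inferInstance, ⟨v, hv, rfl⟩, ?_⟩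
  rintro x hx _ ⟨w, hw, rfl⟩
  exact ⟨_, hs x hx w hw, map_smul g _ _⟩

lemma BorelLocallyFinite.prod {M N : ModuleCat.{0} U} (hM : BorelLocallyFinite M)
    (hN : BorelLocallyFinite N) : BorelLocallyFinite (ModuleCat.of U (M × N)) := fun v => by
  obtain ⟨W, hW, hv, hs⟩ := hM v.1
  obtain ⟨W', hW', hv', hs'⟩ := hN v.2
  let i : M →ₗ[ℂ] ModuleCat.of U (M × N) := (LinearMap.inl U M N).restrictScalars ℂ
  let j : N →ₗ[ℂ] ModuleCat.of U (M × N) := (LinearMap.inr U M N).restrictScalars ℂ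
  refine ⟨W.map i ⊔ W'.map j, inferInstance, ?_, fun x hx w hw => ?_⟩
  · rw [Submodule.mem_sup]
    refine ⟨_, ⟨v.1, hv, rfl⟩, _, ⟨v.2, hv', rfl⟩, ?_⟩
    change ((v.1, 0) + (0, v.2) : M × N) = v
    simp
  · rw [Submodule.mem_sup] at hw ⊢
    obtain ⟨_, ⟨a, ha, rfl⟩, _, ⟨b, hb, rfl⟩, rfl⟩ := hw
    refine ⟨_, ⟨_, hs x hx a ha, rfl⟩, _, ⟨_, hs' x hx b hb, rfl⟩, ?_⟩
    rw [map_add]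
    congr 1
    · exact map_smul (LinearMap.inl U M N) _ _
    · exact map_smul (LinearMap.inr U M N) _ _

lemma mem_of_sum_mem {V : Type} [AddCommGroup V] [Module ℂ V] (T : Module.End ℂ V)
    (N : Submodule ℂ V) (hN : ∀ v ∈ N, T v ∈ N) (s : Finset ℂ) (v : ℂ → V)
    (hv : ∀ c, v c ∈ T.eigenspace c) (hs : ∑ c ∈ s, v c ∈ N) : ∀ c ∈ s, v c ∈ N := by
  induction s using Finset.induction_on generalizing v with
  | empty => simp
  | insert a s ha ih =>
    have h1 : ∑ c ∈ s, (c - a) • v c ∈ N := by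
      have := sub_mem (hN _ hs) (N.smul_mem a hs)
      rw [map_sum, Finset.smul_sum, ← Finset.sum_sub_distrib, Finset.sum_insert ha] at this
      simpa [Module.End.mem_eigenspace_iff.1 (hv _), ← sub_smul] using this
    have h2 := ih (fun c => (c - a) • v c) (fun c => Submodule.smul_mem _ _ (hv c)) h1
    have h3 : ∀ c ∈ s, v c ∈ N := fun c hc => by
      have hne : c - a ≠ 0 := sub_ne_zero.2 fun e => ha (e ▸ hc)
      simpa [smul_smul, inv_mul_cancel₀ hne] using N.smul_mem (c - a)⁻¹ (h2 c hc)
    intro c hc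
    rcases Finset.mem_insert.1 hc with rfl | hc
    · rw [Finset.sum_insert ha] at hs
      simpa using sub_mem hs (sum_mem h3)
    · exact h3 c hc

lemma diag_of_injective {M N : ModuleCat.{0} U} (g : M →ₗ[U] N) (hg : Function.Injective g)
    (hN : ⨆ c : ℂ, (act N h).eigenspace c = ⊤) : ⨆ c : ℂ, (act M h).eigenspace c = ⊤ := by
  rw [eq_top_iff]
  intro m _
  have hm : g m ∈ ⨆ c : ℂ, (act N h).eigenspace c := hN ▸ Submodule.mem_top
  obtain ⟨v, hv, hsum⟩ := (Submodule.mem_iSup_iff_exists_finsupp _ _).1 hm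
  have hr := mem_of_sum_mem (act N h) (LinearMap.range (g.restrictScalars ℂ))
    (by rintro _ ⟨a, rfl⟩; exact ⟨act M h a, map_smul g _ _⟩) v.support v hv
    (by rw [Finsupp.sum] at hsum; rw [hsum]; exact ⟨m, rfl⟩)
  choose! w hw using hr
  have hm' : m = ∑ c ∈ v.support, w c := hg (by
    rw [map_sum, ← hsum, Finsupp.sum]
    exact Finset.sum_congr rfl fun c hc => (hw c hc).symm)
  rw [hm']
  refine sum_mem fun c hc => Submodule.mem_iSup_of_mem c ?_
  rw [Module.End.mem_eigenspace_iff]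
  apply hg
  have h1 := Module.End.mem_eigenspace_iff.1 (hv c)
  rw [← hw c hc] at h1
  exact (map_smul g _ _).trans (h1.trans (map_smul (g.restrictScalars ℂ) _ _).symm)

lemma map_eigenspace {M N : ModuleCat.{0} U} (g : M →ₗ[U] N) (c : ℂ) (m : M)
    (hm : m ∈ (act M h).eigenspace c) : g m ∈ (act N h).eigenspace c := by
  rw [Module.End.mem_eigenspace_iff] at hm ⊢
  rw [act_apply, ← map_smul, ← act_apply, hm]
  exact map_smul (g.restrictScalars ℂ) _ _

lemma map_diag {M N : ModuleCat.{0} U} (g : M →ₗ[U] N)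
    (hM : ⨆ c : ℂ, (act M h).eigenspace c = ⊤) (m : M) :
    g m ∈ ⨆ c : ℂ, (act N h).eigenspace c := by
  have : ⨆ c : ℂ, (act M h).eigenspace c ≤
      (⨆ c : ℂ, (act N h).eigenspace c).comap (g.restrictScalars ℂ) :=
    iSup_le fun c m hm => Submodule.mem_iSup_of_mem c (map_eigenspace g c m hm)
  exact this (hM ▸ Submodule.mem_top)

lemma diag_of_surjective {M N : ModuleCat.{0} U} (g : M →ₗ[U] N) (hg : Function.Surjective g)
    (hM : ⨆ c : ℂ, (act M h).eigenspace c = ⊤) : ⨆ c : ℂ, (act N h).eigenspace c = ⊤ := by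
  rw [eq_top_iff]
  intro n _
  obtain ⟨m, rfl⟩ := hg n
  exact map_diag g hM m

lemma diag_prod {M N : ModuleCat.{0} U} (hM : ⨆ c : ℂ, (act M h).eigenspace c = ⊤)
    (hN : ⨆ c : ℂ, (act N h).eigenspace c = ⊤) :
    ⨆ c : ℂ, (act (ModuleCat.of U (M × N)) h).eigenspace c = ⊤ := by
  rw [eq_top_iff]
  intro v _
  have h1 := map_diag (N := ModuleCat.of U (M × N)) (LinearMap.inl U M N) hM v.1
  have h2 := map_diag (N := ModuleCat.of U (M × N)) (LinearMap.inr U M N) hN v.2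
  have h3 : v = LinearMap.inl U M N v.1 + LinearMap.inr U M N v.2 := by
    change v = ((v.1, 0) + (0, v.2) : M × N)
    simp
  rw [h3]
  exact add_mem h1 h2

/-- Closure under zero, submodules, quotients and products of two modules. -/
structure ClosedProp (P : ObjectProperty (ModuleCat.{0} U)) : Prop where
  zero : P (ModuleCat.of U PUnit)
  inj : ∀ {M N : ModuleCat.{0} U} (g : M →ₗ[U] N), Function.Injective g → P N → P M
  surj : ∀ {M N : ModuleCat.{0} U} (g : M →ₗ[U] N), Function.Surjective g → P M → P N
  prod : ∀ {M N : ModuleCat.{0} U}, P M → P N → P (ModuleCat.of U (M × N))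

lemma thickO_closed : ClosedProp thickO where
  zero := ⟨inferInstanceAs (Module.Finite U PUnit), fun _ => ⟨⊥, inferInstance,
    Subsingleton.elim _ _, fun _ _ _ _ => Subsingleton.elim _ _⟩⟩
  inj g hg hN := ⟨have := hN.1; Module.Finite.of_injective g hg, hN.2.of_injective g hg⟩
  surj g hg hM := ⟨have := hM.1; Module.Finite.of_surjective g hg, hM.2.of_surjective g hg⟩
  prod {M N} hM hN := ⟨have := hM.1; have := hN.1; inferInstanceAs (Module.Finite U (M × N)),
    hM.2.prod hN.2⟩

lemma catO_closed : ClosedProp catO where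
  zero := ⟨thickO_closed.zero, Subsingleton.elim _ _⟩
  inj g hg hN := ⟨thickO_closed.inj g hg hN.1, diag_of_injective g hg hN.2⟩
  surj g hg hM := ⟨thickO_closed.surj g hg hM.1, diag_of_surjective g hg hM.2⟩
  prod hM hN := ⟨thickO_closed.prod hM.1 hN.1, diag_prod hM.2 hN.2⟩

lemma IsSubquotient.of_injective {S M N : ModuleCat.{0} U} (g : M →ₗ[U] N)
    (hg : Function.Injective g) (hS : IsSubquotient S M) : IsSubquotient S N := by
  obtain ⟨K, p, hp⟩ := hS
  let e := Submodule.equivMapOfInjective g hg K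
  exact ⟨K.map g, p ∘ₗ e.symm.toLinearMap, hp.comp e.symm.surjective⟩

lemma IsSubquotient.of_surjective {S M N : ModuleCat.{0} U} (g : M →ₗ[U] N)
    (hg : Function.Surjective g) (hS : IsSubquotient S N) : IsSubquotient S M := by
  obtain ⟨K, p, hp⟩ := hS
  refine ⟨K.comap g, p ∘ₗ g.restrict (p := K.comap g) (q := K) fun _ h => h, hp.comp ?_⟩
  rintro ⟨k, hk⟩
  obtain ⟨m, rfl⟩ := hg k
  exact ⟨⟨m, hk⟩, rfl⟩

lemma exists_of_prod {S M N : Type} [AddCommGroup S] [AddCommGroup M] [AddCommGroup N] [Module U S]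
    [Module U M] [Module U N] [IsSimpleModule U S] (K : Submodule U (M × N)) (p : K →ₗ[U] S)
    (hp : Function.Surjective p) :
    (∃ (K' : Submodule U M) (p' : K' →ₗ[U] S), Function.Surjective p') ∨
      ∃ (K' : Submodule U N) (p' : K' →ₗ[U] S), Function.Surjective p' := by
  let q : K →ₗ[U] M := LinearMap.fst U M N ∘ₗ K.subtype
  let r : K →ₗ[U] N := LinearMap.snd U M N ∘ₗ K.subtype
  rcases eq_bot_or_eq_top ((LinearMap.ker q).map p) with h0 | h1
  · left
    have hle : LinearMap.ker q ≤ LinearMap.ker p := fun k hk => by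
      have : p k ∈ (LinearMap.ker q).map p := ⟨k, hk, rfl⟩
      rw [h0] at this
      exact this
    let t : (K ⧸ LinearMap.ker q) →ₗ[U] S := (LinearMap.ker q).liftQ p hle
    refine ⟨LinearMap.range q, t ∘ₗ q.quotKerEquivRange.symm.toLinearMap, fun s => ?_⟩
    obtain ⟨k, rfl⟩ := hp s
    refine ⟨q.quotKerEquivRange (Submodule.Quotient.mk k), ?_⟩
    rw [LinearMap.comp_apply, LinearEquiv.coe_coe, LinearEquiv.symm_apply_apply]
    exact Submodule.liftQ_apply _ _ _
  · right
    let r' : LinearMap.ker q →ₗ[U] N := r ∘ₗ (LinearMap.ker q).subtype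
    have hr : Function.Injective r' := by
      rintro ⟨a, ha⟩ ⟨b, hb⟩ hab
      apply Subtype.ext
      apply Subtype.ext
      apply Prod.ext
      · exact (LinearMap.mem_ker.1 ha).trans (LinearMap.mem_ker.1 hb).symm
      · exact hab
    let e := LinearEquiv.ofInjective r' hr
    refine ⟨LinearMap.range r', (p ∘ₗ (LinearMap.ker q).subtype) ∘ₗ e.symm.toLinearMap,
      fun s => ?_⟩
    have : s ∈ (LinearMap.ker q).map p := h1 ▸ Submodule.mem_top
    obtain ⟨k, hk, rfl⟩ := this
    refine ⟨e ⟨k, hk⟩, ?_⟩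
    rw [LinearMap.comp_apply, LinearEquiv.coe_coe, LinearEquiv.symm_apply_apply]
    rfl

lemma IsSubquotient.of_prod {S M N : ModuleCat.{0} U} (hS' : Simple S)
    (hS : IsSubquotient S (ModuleCat.of U (M × N))) : IsSubquotient S M ∨ IsSubquotient S N := by
  have hsimple : IsSimpleModule U S := simple_iff_isSimpleModule.1 hS'
  obtain ⟨K, p, hp⟩ := hS
  exact exists_of_prod K p hp

lemma ClosedProp.block {X : ObjectProperty (ModuleCat.{0} U)} (hX : ClosedProp X) (μ : Weight) :
    ClosedProp (block X μ) where
  zero := ⟨hX.zero, fun S hS hS' => by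
    have := simple_iff_isSimpleModule.1 hS'
    obtain ⟨K, p, hp⟩ := hS
    have : Subsingleton K := ⟨fun a b => Subtype.ext (Subsingleton.elim (α := PUnit) _ _)⟩
    exact absurd hp.subsingleton (not_subsingleton_iff_nontrivial.2
      (IsSimpleModule.nontrivial U S))⟩
  inj g hg hN := ⟨hX.inj g hg hN.1, fun S hS hS' => hN.2 S (hS.of_injective g hg) hS'⟩
  surj g hg hM := ⟨hX.surj g hg hM.1, fun S hS hS' => hM.2 S (hS.of_surjective g hg) hS'⟩
  prod hM hN := ⟨hX.prod hM.1 hN.1, fun S hS hS' =>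
    (hS.of_prod hS').elim (fun h => hM.2 S h hS') (fun h => hN.2 S h hS')⟩

lemma ClosedProp.sub {P : ObjectProperty (ModuleCat.{0} U)} (hP : ClosedProp P) :
    P.IsClosedUnderSubobjects where
  prop_of_mono g _ hY := hP.inj g.hom ((ModuleCat.mono_iff_injective g).1 inferInstance) hY

lemma ClosedProp.quot {P : ObjectProperty (ModuleCat.{0} U)} (hP : ClosedProp P) :
    P.IsClosedUnderQuotients where
  prop_of_epi g _ hX := hP.surj g.hom ((ModuleCat.epi_iff_surjective g).1 inferInstance) hX

lemma ClosedProp.containsZero {P : ObjectProperty (ModuleCat.{0} U)} (hP : ClosedProp P) :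
    P.ContainsZero where
  exists_zero := ⟨ModuleCat.of U PUnit, ModuleCat.isZero_of_subsingleton _, hP.zero⟩

lemma ClosedProp.finiteProducts {P : ObjectProperty (ModuleCat.{0} U)} (hP : ClosedProp P) :
    P.IsClosedUnderFiniteProducts := by
  have := hP.sub
  have := hP.containsZero
  have : P.IsClosedUnderBinaryProducts := ⟨by
    rintro X ⟨p⟩
    let a : X →ₗ[U] p.diag.obj ⟨WalkingPair.left⟩ := (p.π.app ⟨WalkingPair.left⟩).hom
    let b : X →ₗ[U] p.diag.obj ⟨WalkingPair.right⟩ := (p.π.app ⟨WalkingPair.right⟩).hom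
    refine hP.inj (N := ModuleCat.of U (p.diag.obj ⟨WalkingPair.left⟩ ×
      p.diag.obj ⟨WalkingPair.right⟩)) (a.prod b) ?_
      (hP.prod (p.prop_diag_obj _) (p.prop_diag_obj _))
    intro u v huv
    have h1 : a u = a v := congrArg Prod.fst huv
    have h2 : b u = b v := congrArg Prod.snd huv
    let gu : ModuleCat.of U U ⟶ X := ModuleCat.ofHom (LinearMap.toSpanSingleton U X u)
    let gv : ModuleCat.of U U ⟶ X := ModuleCat.ofHom (LinearMap.toSpanSingleton U X v)
    have : gu = gv := p.isLimit.hom_ext (by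
      rintro ⟨_ | _⟩
      · ext
        simpa [gu, gv] using h1
      · ext
        simpa [gu, gv] using h2)
    have := congrArg (fun g : ModuleCat.of U U ⟶ X => g.hom 1) this
    simpa [gu, gv] using this⟩
  exact ObjectProperty.IsClosedUnderFiniteProducts.mk'

/-- The block `O(μ)` of classical category `O`. -/
abbrev BlockO (μ : Weight) : Type 1 := (block catO μ).FullSubcategory

/-- The block of thick category `O` attached to `μ`. -/
abbrev BlockThickO (μ : Weight) : Type 1 := (block thickO μ).FullSubcategory

noncomputable instance (μ : Weight) : Abelian (BlockO μ) :=
  have hP := catO_closed.block μ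
  have := hP.sub
  have := hP.quot
  have := hP.containsZero
  have := hP.finiteProducts
  inferInstance

noncomputable instance (μ : Weight) : Abelian (BlockThickO μ) :=
  have hP := thickO_closed.block μ
  have := hP.sub
  have := hP.quot
  have := hP.containsZero
  have := hP.finiteProducts
  inferInstance

end Takiff

/-! ### Gabriel quivers -/

section Gabriel

universe v u

/-- The vertices of the Gabriel quiver of a `ℂ`-linear abelian category: isomorphism classes of
simple objects. -/
def GabrielQuiver (C : Type u) [Category.{v} C] [Abelian C] : Type u :=
  Quotient (isIsomorphicSetoid (ObjectProperty.FullSubcategory fun X : C => Simple X))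

/-- A simple object in the isomorphism class. -/
noncomputable def GabrielQuiver.rep {C : Type u} [Category.{v} C] [Abelian C]
    (a : GabrielQuiver C) : C :=
  (Quotient.out (s := isIsomorphicSetoid (ObjectProperty.FullSubcategory fun X : C => Simple X))
    a).obj

/-- The arrows of the Gabriel quiver from `L` to `S`: the index set of a basis of `Ext¹(L, S)`,
so that their number is the dimension of this space. -/
noncomputable instance (C : Type u) [Category.{v} C] [Abelian C] [Linear ℂ C] :
    Quiver (GabrielQuiver C) where
  Hom a b :=
    haveI : HasExt.{max u v} C := HasExt.standard C
    Module.Free.ChooseBasisIndex ℂ (Abelian.Ext.{max u v} a.rep b.rep 1)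

/-- An isomorphism of quivers. -/
structure QuiverIso (V : Type u) (W : Type v) [Quiver V] [Quiver W] where
  vertices : V ≃ W
  arrows : ∀ a b : V, (a ⟶ b) ≃ (vertices a ⟶ vertices b)

/-- The quiver with one vertex and `n` loops. -/
def LoopQuiver (_n : ℕ) : Type := Unit

instance (n : ℕ) : Quiver (LoopQuiver n) where
  Hom _ _ := Fin n

end Gabriel

/-!
Write `a = μ(h)` and `b = μ(hBar) ≠ 0`. In the support of a simple module of the block, `μ` occurs
and `μ + α` does not. So the module has a highest weight vector of weight `μ`, and is a quotient
of the Verma module `L` of this weight. For `b ≠ 0` this Verma module is itself simple: realized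
on polynomials `fⁱ fBarʲ`, a vector killed by `e` and `eBar` is seen from its coefficients to have
degree zero (`verma.eq_mon_of_singular`), and `e`, `eBar` lower the degree. So both blocks have
`L` as their only simple object.

In an extension `0 ⟶ L ⟶ M ⟶ L ⟶ 0`, the highest weight vector of the quotient can be lifted to a
vector `v` with `e v = eBar v = 0`, for which `(h - a) v` and `(hBar - b) v` are multiples, by `s`
and `t`, of the highest weight vector of the submodule (`exists_almost_highest_weight_vector`).
The pair `(s, t)` determines the extension. It is arbitrary in the thick category, while `s = 0`
if `h` is diagonalizable, so that `Ext¹(L, L)` has dimension two and one respectively.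

To compute `Ext¹` in the block without having projective objects there, one takes the universal
extension `0 ⟶ K ⟶ P ⟶ L ⟶ 0`: `P` is the Verma module induced from `ℂ × ℂⁿ` (`vermaExt`), where
`h - a` and `hBar - b` send `(1, 0)` to vectors `α` and `β` spanning `ℂⁿ`, and `K` is the sum of
`n` copies of `L` induced from `ℂⁿ`. `P` is in the block, it maps to every extension `M` by the
universal property of Verma modules, and its maps to `L` vanish on `K`. These properties make the
connecting map `Hom(K, L) ⟶ Ext¹(L, L)` bijective (`Ext.nonempty_hom_linearEquiv`), and
`Hom(K, L)` is `n`-dimensional.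
-/

/-! ### Extensions and the Gabriel quiver of an abelian category -/

section ExtOne

open Pretriangulated Triangulated Abelian

universe w v u

/-- Every class in `Ext¹(X, Y)` becomes zero on the middle term `E` of some extension of `X` by `Y`:
the cone of the corresponding morphism `X ⟶ Y[1]` of the derived category, shifted by `-1`, is
concentrated in degree zero. -/
lemma CategoryTheory.Abelian.Ext.exists_shortExact_comp_eq_zero {C : Type u} [Category.{v} C]
    [Abelian C] [HasExt.{w} C] {X Y : C} (x : Ext.{w} X Y 1) :
    ∃ (E : C) (i : Y ⟶ E) (p : E ⟶ X) (h : i ≫ p = 0),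
      (ShortComplex.mk i p h).ShortExact ∧ (Ext.mk₀ p).comp x (zero_add 1) = 0 := by
  let := HasDerivedCategory.standard C
  let F := DerivedCategory.singleFunctor C 0
  obtain ⟨y, hy⟩ : ∃ y : F.obj X ⟶ (F.obj Y)⟦(1 : ℤ)⟧, y = x.hom := ⟨x.hom, rfl⟩
  obtain ⟨Z, i, p, hT⟩ := distinguished_cocone_triangle₂ y
  have h1 : Z.IsLE 0 := DerivedCategory.TStructure.t.isLE₂ _ hT 0
    (inferInstanceAs ((DerivedCategory.singleFunctor C 0).obj Y |>.IsLE 0))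
    (inferInstanceAs ((DerivedCategory.singleFunctor C 0).obj X |>.IsLE 0))
  have h2 : Z.IsGE 0 := DerivedCategory.TStructure.t.isGE₂ _ hT 0
    (inferInstanceAs ((DerivedCategory.singleFunctor C 0).obj Y |>.IsGE 0))
    (inferInstanceAs ((DerivedCategory.singleFunctor C 0).obj X |>.IsGE 0))
  obtain ⟨E, ⟨e⟩⟩ := Z.exists_iso_singleFunctor_obj_of_isGE_of_isLE 0
  obtain ⟨i', hi'⟩ := F.map_surjective (i ≫ e.hom)
  obtain ⟨p', hp'⟩ := F.map_surjective (e.inv ≫ p)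
  have hT' : Triangle.mk (F.map i') (F.map p') y ∈ distTriang (DerivedCategory C) := by
    refine isomorphic_distinguished _ hT _ ?_
    refine Triangle.isoMk _ _ (Iso.refl _) e.symm (Iso.refl _) ?_ ?_ ?_
    · change F.map i' ≫ e.inv = 𝟙 _ ≫ i
      simp [hi']
    · change F.map p' ≫ 𝟙 _ = e.inv ≫ p
      rw [hp', Category.comp_id]
    · change y ≫ (𝟙 (F.obj Y))⟦(1 : ℤ)⟧' = 𝟙 _ ≫ y
      simp
  have hι : ∀ ⦃A B : C⦄ ⦃n : ℤ⦄ (f : F.obj A ⟶ (F.obj B)⟦n⟧), n < 0 → f = 0 := by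
    intro A B n f hn
    have := DerivedCategory.TStructure.t.isGE_shift (F.obj B) 0 n (-n)
    exact DerivedCategory.TStructure.t.zero f 0 (-n)
  have hz : i' ≫ p' = 0 := F.map_injective (by
    have : F.map i' ≫ F.map p' = 0 := comp_distTriang_mor_zero₁₂ _ hT'
    rw [F.map_comp, this, F.map_zero])
  have hk := AbelianSubcategory.isLimitKernelForkOfDistTriang hι _ _ _ hT'
  have hc := AbelianSubcategory.isColimitCokernelCoforkOfDistTriang hι _ _ _ hT'
  refine ⟨E, i', p', hz, ?_, ?_⟩
  · have := Fork.IsLimit.mono hk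
    have := Cofork.IsColimit.epi hc
    exact { exact := ShortComplex.exact_of_f_is_kernel _ hk
            mono_f := by assumption
            epi_g := by assumption }
  · ext
    have : F.map p' ≫ y = 0 := comp_distTriang_mor_zero₂₃ _ hT'
    rw [Ext.comp_hom, Ext.mk₀_hom, ShiftedHom.mk₀_comp, Ext.zero_hom]
    exact hy ▸ this

/-- Let `0 ⟶ K ⟶ P ⟶ X ⟶ 0` be exact, such that `P` maps to every extension of `X` by `Y`, over
`X`, and all maps `P ⟶ Y` vanish on `K`. Then the connecting map from `Hom(K, Y)` to `Ext¹(X, Y)` is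
bijective. So `P` plays the role of a projective cover, although the category need not have
projective objects. -/
lemma CategoryTheory.Abelian.Ext.nonempty_hom_linearEquiv {k : Type*} [Field k] {C : Type u}
    [Category.{v} C] [Abelian C] [Linear k C] [HasExt.{w} C] {S : ShortComplex C}
    (hS : S.ShortExact) {Y : C} (hzero : ∀ φ : S.X₂ ⟶ Y, S.f ≫ φ = 0)
    (hlift : ∀ {E : C} (i : Y ⟶ E) (p : E ⟶ S.X₃) (h : i ≫ p = 0),
      (ShortComplex.mk i p h).ShortExact → ∃ l : S.X₂ ⟶ E, l ≫ p = S.g) :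
    Nonempty ((S.X₁ ⟶ Y) ≃ₗ[k] Ext.{w} S.X₃ Y 1) := by
  let δ : (S.X₁ ⟶ Y) →ₗ[k] Ext.{w} S.X₃ Y 1 :=
    { toFun := fun φ => hS.extClass.comp (Ext.mk₀ φ) (add_zero 1)
      map_add' := fun φ ψ => by rw [Ext.mk₀_add, Ext.comp_add]
      map_smul' := fun c φ => by rw [Ext.mk₀_smul, Ext.comp_smul, RingHom.id_apply] }
  refine ⟨LinearEquiv.ofBijective δ ⟨?_, fun x => ?_⟩⟩
  · rw [injective_iff_map_eq_zero]
    intro φ hφ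
    obtain ⟨y, hy⟩ := Ext.contravariant_sequence_exact₁ hS Y (Ext.mk₀ φ) (add_zero 1) hφ
    rw [← Ext.mk₀_homEquiv₀_apply y, Ext.mk₀_comp_mk₀, hzero, Ext.mk₀_zero] at hy
    exact (Ext.mk₀_eq_zero_iff φ).1 hy.symm
  · obtain ⟨E, i, p, h, hE, hx⟩ := Ext.exists_shortExact_comp_eq_zero x
    obtain ⟨l, hl⟩ := hlift i p h hE
    have hx' : (Ext.mk₀ S.g).comp x (zero_add 1) = 0 := by
      rw [← hl, ← Ext.mk₀_comp_mk₀_assoc, hx, Ext.comp_zero]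
    obtain ⟨y, hy⟩ := Ext.contravariant_sequence_exact₃ hS Y x hx' (add_zero 1)
    refine ⟨Ext.homEquiv₀ y, ?_⟩
    change hS.extClass.comp (Ext.mk₀ (Ext.homEquiv₀ y)) (add_zero 1) = x
    rw [Ext.mk₀_homEquiv₀_apply, hy]

/-- Self-extensions of isomorphic objects. -/
noncomputable def CategoryTheory.Abelian.Ext.linearEquivOfIso {k : Type*} [Field k] {C : Type u}
    [Category.{v} C] [Abelian C] [Linear k C] [HasExt.{w} C] {X Y : C} (e : X ≅ Y) {n : ℕ} :
    Ext.{w} X X n ≃ₗ[k] Ext.{w} Y Y n where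
  toFun x := (Ext.mk₀ e.inv).comp (x.comp (Ext.mk₀ e.hom) (add_zero n)) (zero_add n)
  invFun x := (Ext.mk₀ e.hom).comp (x.comp (Ext.mk₀ e.inv) (add_zero n)) (zero_add n)
  map_add' x y := by rw [Ext.add_comp, Ext.comp_add]
  map_smul' c x := by rw [Ext.smul_comp, Ext.comp_smul, RingHom.id_apply]
  left_inv x := by simp [Ext.mk₀_comp_mk₀_assoc]
  right_inv x := by simp [Ext.mk₀_comp_mk₀_assoc]

/-- The Gabriel quiver in case of a single simple object `L` with `n`-dimensional
`Ext¹(L, L)`. -/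
lemma GabrielQuiver.nonempty_quiverIso_loopQuiver {C : Type u} [Category.{v} C] [Abelian C]
    [Linear ℂ C] (n : ℕ) (L : C) (hL : Simple L) (hiso : ∀ S : C, Simple S → Nonempty (L ≅ S))
    (hext : haveI : HasExt.{max u v} C := HasExt.standard C
      Nonempty ((Fin n → ℂ) ≃ₗ[ℂ] Ext.{max u v} L L 1)) :
    Nonempty (QuiverIso (GabrielQuiver C) (LoopQuiver n)) := by
  have hsub : Subsingleton (GabrielQuiver C) := ⟨by
    rintro ⟨S⟩ ⟨T⟩
    obtain ⟨e⟩ := hiso S.obj S.property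
    obtain ⟨e'⟩ := hiso T.obj T.property
    exact Quotient.sound ⟨ObjectProperty.isoMk _ (e.symm ≪≫ e')⟩⟩
  let a₀ : GabrielQuiver C := Quotient.mk (isIsomorphicSetoid _) ⟨L, hL⟩
  have harr : ∀ a b : GabrielQuiver C, Nonempty ((a ⟶ b) ≃ Fin n) := by
    intro a b
    obtain rfl := Subsingleton.elim a b
    have : HasExt.{max u v} C := HasExt.standard C
    obtain ⟨ψ⟩ := hext
    obtain ⟨e⟩ := hiso a.rep (Quotient.out (s := isIsomorphicSetoid _) a).property
    exact ⟨(Module.Free.chooseBasis ℂ (Abelian.Ext.{max u v} a.rep a.rep 1)).indexEquiv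
      ((Pi.basisFun ℂ (Fin n)).map (ψ ≪≫ₗ Ext.linearEquivOfIso e))⟩
  exact ⟨⟨⟨fun _ => (), fun _ => a₀, fun _ => Subsingleton.elim _ _, fun _ => rfl⟩,
    fun a b => (harr a b).some⟩⟩

end ExtOne

namespace Takiff

/-! ### Generators and relations of the Takiff algebra -/

section Generators

lemma val_zero_zero_add (g : LieAlgebra.SpecialLinear.sl (Fin 2) ℂ) :
    g.val 0 0 + g.val 1 1 = 0 := by
  have h : Matrix.trace g.val = 0 := g.2
  rwa [Matrix.trace_fin_two] at h

lemma sl_eq (g : LieAlgebra.SpecialLinear.sl (Fin 2) ℂ) :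
    g = g.val 0 1 • slE + g.val 0 0 • slH + g.val 1 0 • slF := by
  have htr := val_zero_zero_add g
  apply Subtype.ext
  ext i j
  fin_cases i <;> fin_cases j <;> simp [slE, slH, slF]
  linear_combination htr

lemma lie_slH_slE : ⁅slH, slE⁆ = (2 : ℂ) • slE := by
  apply Subtype.ext
  ext i j
  fin_cases i <;> fin_cases j <;> simp [slE, slH, LieSubalgebra.coe_bracket, Ring.lie_def,
    Matrix.mul_apply]
  norm_num

lemma lie_h_e : ⁅h, e⁆ = (2 : ℂ) • e := by
  simp [e, h, LieAlgebra.ExtendScalars.bracket_tmul, lie_slH_slE]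
lemma lie_h_eBar : ⁅h, eBar⁆ = (2 : ℂ) • eBar := by
  simp [eBar, h, LieAlgebra.ExtendScalars.bracket_tmul, lie_slH_slE]
lemma lie_hBar_e : ⁅hBar, e⁆ = (2 : ℂ) • eBar := by
  simp [e, eBar, hBar, LieAlgebra.ExtendScalars.bracket_tmul, lie_slH_slE]
lemma lie_hBar_eBar : ⁅hBar, eBar⁆ = 0 := by
  simp [eBar, hBar, LieAlgebra.ExtendScalars.bracket_tmul]
lemma lie_h_hBar : ⁅h, hBar⁆ = 0 := by
  simp [hBar, h, LieAlgebra.ExtendScalars.bracket_tmul]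

lemma lie_fBar_f : ⁅fBar, f⁆ = 0 := by
  simp [fBar, f, LieAlgebra.ExtendScalars.bracket_tmul]

lemma span_generators : Submodule.span ℂ {e, h, f, eBar, hBar, fBar} = ⊤ := by
  rw [eq_top_iff]
  rintro x -
  have hm : ∀ y ∈ ({e, h, f, eBar, hBar, fBar} : Set Takiff),
      y ∈ Submodule.span ℂ {e, h, f, eBar, hBar, fBar} := fun y hy => Submodule.subset_span hy
  induction x using TensorProduct.induction_on with
  | zero => exact zero_mem _
  | add x y hx hy => exact add_mem hx hy
  | tmul d g =>
    have key : d ⊗ₜ[ℂ] g = d.fst • (g.val 0 1 • e + g.val 0 0 • h + g.val 1 0 • f) +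
        d.snd • (g.val 0 1 • eBar + g.val 0 0 • hBar + g.val 1 0 • fBar) := by
      have hd : d = d.fst • (1 : DualNumber ℂ) + d.snd • DualNumber.eps := by
        ext <;> simp
      conv_lhs => rw [hd, sl_eq g]
      simp only [TensorProduct.add_tmul, TensorProduct.tmul_add, ← TensorProduct.smul_tmul',
        TensorProduct.tmul_smul, e, h, f, eBar, hBar, fBar]
      module
    rw [key]
    refine add_mem (Submodule.smul_mem _ _ (add_mem (add_mem ?_ ?_) ?_))
      (Submodule.smul_mem _ _ (add_mem (add_mem ?_ ?_) ?_)) <;>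
    exact Submodule.smul_mem _ _ (hm _ (by simp))

/-- `E, H, F, E', H', F'` satisfy the bracket relations of the basis `e, h, f, eBar, hBar, fBar`
of the Takiff algebra. -/
structure Relations {A : Type*} [LieRing A] [LieAlgebra ℂ A] (E H F E' H' F' : A) : Prop where
  e_f : ⁅E, F⁆ = H
  e_fBar : ⁅E, F'⁆ = H'
  eBar_f : ⁅E', F⁆ = H'
  eBar_fBar : ⁅E', F'⁆ = 0
  h_e : ⁅H, E⁆ = (2 : ℂ) • E
  h_eBar : ⁅H, E'⁆ = (2 : ℂ) • E'
  hBar_e : ⁅H', E⁆ = (2 : ℂ) • E'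
  hBar_eBar : ⁅H', E'⁆ = 0
  h_f : ⁅H, F⁆ = (-2 : ℂ) • F
  h_fBar : ⁅H, F'⁆ = (-2 : ℂ) • F'
  hBar_f : ⁅H', F⁆ = (-2 : ℂ) • F'
  hBar_fBar : ⁅H', F'⁆ = 0
  h_hBar : ⁅H, H'⁆ = 0
  e_eBar : ⁅E, E'⁆ = 0
  f_fBar : ⁅F, F'⁆ = 0

variable {A : Type*} [LieRing A] [LieAlgebra ℂ A] {E H F E' H' F' : A}

/-- The linear map on `sl₂` with `e ↦ E`, `h ↦ H`, `f ↦ F`. -/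
noncomputable def slMap (E H F : A) : LieAlgebra.SpecialLinear.sl (Fin 2) ℂ →ₗ[ℂ] A where
  toFun g := g.val 0 1 • E + g.val 0 0 • H + g.val 1 0 • F
  map_add' x y := by simp [add_smul]; abel
  map_smul' c x := by simp [smul_smul]

/-- The linear map on the Takiff algebra sending its basis to `E, H, F, E', H', F'`. -/
noncomputable def Relations.linearMap (E H F E' H' F' : A) : Takiff →ₗ[ℂ] A :=
  TensorProduct.lift (LinearMap.mk₂ ℂ (fun (d : DualNumber ℂ) g =>
      d.fst • slMap E H F g + d.snd • slMap E' H' F' g)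
    (fun _ _ _ => by simp only [TrivSqZeroExt.fst_add, TrivSqZeroExt.snd_add]; module)
    (fun _ _ _ => by simp only [TrivSqZeroExt.fst_smul, TrivSqZeroExt.snd_smul]; module)
    (fun _ _ _ => by simp only [map_add]; module)
    (fun _ _ _ => by simp only [map_smul]; module))

set_option maxHeartbeats 1000000 in
/-- Elements satisfying the bracket relations of the basis define a homomorphism on the Takiff
algebra. -/
noncomputable def Relations.lieHom (R : Relations E H F E' H' F') : Takiff →ₗ⁅ℂ⁆ A :=
  { Relations.linearMap E H F E' H' F' with
    map_lie' := by
      intro x y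
      change linearMap E H F E' H' F' ⁅x, y⁆ =
        ⁅linearMap E H F E' H' F' x, linearMap E H F E' H' F' y⁆
      induction x using TensorProduct.induction_on with
      | zero =>
        rw [map_zero, zero_lie]
        exact (congrArg _ (zero_lie (L := Takiff) y)).trans (map_zero _)
      | add x x' hx hx' =>
        rw [map_add, add_lie, ← hx, ← hx', ← map_add]
        exact congrArg _ (add_lie x x' y)
      | tmul s x =>
        induction y using TensorProduct.induction_on with
        | zero =>
          rw [map_zero, lie_zero]
          exact (congrArg _ (lie_zero (M := Takiff) (s ⊗ₜ[ℂ] x))).trans (map_zero _)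
        | add y y' hy hy' =>
          rw [map_add, lie_add, ← hy, ← hy', ← map_add]
          exact congrArg _ (lie_add (s ⊗ₜ[ℂ] x) y y')
        | tmul t y =>
          have hx : x.val 1 1 = -x.val 0 0 :=
            eq_neg_of_add_eq_zero_right (val_zero_zero_add x)
          have hy : y.val 1 1 = -y.val 0 0 :=
            eq_neg_of_add_eq_zero_right (val_zero_zero_add y)
          rw [LieAlgebra.ExtendScalars.bracket_tmul]
          simp only [linearMap, TensorProduct.lift.tmul, LinearMap.mk₂_apply, slMap,
            LinearMap.coe_mk, AddHom.coe_mk, LieSubalgebra.coe_bracket, Ring.lie_def,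
            Matrix.sub_apply, Matrix.mul_apply, Fin.sum_univ_two, hx, hy,
            TrivSqZeroExt.fst_mul, TrivSqZeroExt.snd_mul, lie_add, add_lie, lie_smul, smul_lie,
            smul_add, lie_self, R.e_f, R.e_fBar, R.eBar_f, R.eBar_fBar, R.h_e, R.h_eBar, R.hBar_e,
            R.hBar_eBar,
            R.h_f, R.h_fBar, R.hBar_f, R.hBar_fBar, R.h_hBar, R.e_eBar, R.f_fBar,
            ← lie_skew E H, ← lie_skew E' H, ← lie_skew E H', ← lie_skew E' H',
            ← lie_skew F H, ← lie_skew F' H, ← lie_skew F H', ← lie_skew F' H',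
            ← lie_skew F E, ← lie_skew F' E, ← lie_skew F E', ← lie_skew F' E',
            ← lie_skew H' H, ← lie_skew E' E, ← lie_skew F' F, op_smul_eq_smul, smul_eq_mul]
          module }

variable (R : Relations E H F E' H' F')

lemma Relations.lieHom_e : R.lieHom e = E := by
  change linearMap E H F E' H' F' e = E
  simp [linearMap, e, slMap, slE]

lemma Relations.lieHom_h : R.lieHom h = H := by
  change linearMap E H F E' H' F' h = H
  simp [linearMap, h, slMap, slH]

lemma Relations.lieHom_f : R.lieHom f = F := by
  change linearMap E H F E' H' F' f = F
  simp [linearMap, f, slMap, slF]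

lemma Relations.lieHom_eBar : R.lieHom eBar = E' := by
  change linearMap E H F E' H' F' eBar = E'
  simp [linearMap, eBar, slMap, slE]

lemma Relations.lieHom_hBar : R.lieHom hBar = H' := by
  change linearMap E H F E' H' F' hBar = H'
  simp [linearMap, hBar, slMap, slH]

lemma Relations.lieHom_fBar : R.lieHom fBar = F' := by
  change linearMap E H F E' H' F' fBar = F'
  simp [linearMap, fBar, slMap, slF]

end Generators

end Takiff

namespace Takiff

attribute [local instance 100] LieRing.ofAssociativeRing LieAlgebra.ofAssociativeAlgebra

local notation "ι" => UniversalEnvelopingAlgebra.ι ℂ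

/-! ### Differential operators on polynomials -/

section DifferentialOperators

/-- `dx`, `dy` are derivations with respect to `x`, `y`, and all four commute with the commuting
elements `a`, `b`: the relations of the Weyl algebra in two variables over `ℂ[a, b]`. -/
structure WeylRelations {W : Type*} [Ring W] (x y dx dy a b : W) : Prop where
  dx_x : dx * x = x * dx + 1
  dy_y : dy * y = y * dy + 1
  y_x : y * x = x * y
  dx_y : dx * y = y * dx
  dy_x : dy * x = x * dy
  dy_dx : dy * dx = dx * dy
  x_a : x * a = a * x
  y_a : y * a = a * y
  dx_a : dx * a = a * dx
  dy_a : dy * a = a * dy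
  x_b : x * b = b * x
  y_b : y * b = b * y
  dx_b : dx * b = b * dx
  dy_b : dy * b = b * dy
  b_a : b * a = a * b

lemma mul_assoc_of_mul_eq {W : Type*} [Ring W] {p q r : W} (h : p * q = r) (t : W) :
    p * (q * t) = r * t := by rw [← mul_assoc, h]

set_option maxHeartbeats 1000000 in
/-- The Takiff algebra acts by differential operators with coefficients in `ℂ[a, b]`. These are the
formulas for its action on the Verma module induced from `h ↦ a`, `hBar ↦ b`, where `f` and `fBar`
are multiplication by `x` and `y`. -/
lemma WeylRelations.relations {W : Type*} [Ring W] [Algebra ℂ W] {x y dx dy a b : W}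
    (w : WeylRelations x y dx dy a b) :
    Relations (a * dx - x * (dx * dx) + b * dy - (2 : ℂ) • (y * (dx * dy)))
      (a - (2 : ℂ) • (x * dx) - (2 : ℂ) • (y * dy)) x
      (b * dx - y * (dx * dx)) (b - (2 : ℂ) • (y * dx)) y := by
  constructor <;>
  · simp only [Ring.lie_def, mul_add, add_mul, mul_sub, sub_mul, smul_mul_assoc, mul_smul_comm,
      mul_assoc, smul_add, smul_sub, mul_one, one_mul,
      w.dx_x, w.dy_y, w.y_x, w.dx_y, w.dy_x, w.dy_dx, w.x_a, w.y_a, w.dx_a, w.dy_a, w.x_b, w.y_b,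
      w.dx_b, w.dy_b, w.b_a, mul_assoc_of_mul_eq w.dx_x, mul_assoc_of_mul_eq w.dy_y,
      mul_assoc_of_mul_eq w.y_x, mul_assoc_of_mul_eq w.dx_y, mul_assoc_of_mul_eq w.dy_x,
      mul_assoc_of_mul_eq w.dy_dx, mul_assoc_of_mul_eq w.x_a, mul_assoc_of_mul_eq w.y_a,
      mul_assoc_of_mul_eq w.dx_a, mul_assoc_of_mul_eq w.dy_a, mul_assoc_of_mul_eq w.x_b,
      mul_assoc_of_mul_eq w.y_b, mul_assoc_of_mul_eq w.dx_b, mul_assoc_of_mul_eq w.dy_b,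
      mul_assoc_of_mul_eq w.b_a]
    module

variable {E : Type*} [AddCommGroup E] [Module ℂ E]

/-- Polynomials in `x, y` with coefficients in `E`; the value at `(i, j)` is the coefficient of
`xⁱ yʲ`. -/
abbrev Poly (E : Type*) [AddCommGroup E] : Type _ := ℕ × ℕ →₀ E

/-- Multiplication by `x`. -/
noncomputable def mulX : Module.End ℂ (Poly E) :=
  Finsupp.lmapDomain E ℂ fun p => (p.1 + 1, p.2)

/-- Multiplication by `y`. -/
noncomputable def mulY : Module.End ℂ (Poly E) :=
  Finsupp.lmapDomain E ℂ fun p => (p.1, p.2 + 1)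

/-- The partial derivative in `x`. -/
noncomputable def derivX : Module.End ℂ (Poly E) :=
  Finsupp.lsum ℂ fun p => (p.1 : ℂ) • Finsupp.lsingle (p.1 - 1, p.2)

/-- The partial derivative in `y`. -/
noncomputable def derivY : Module.End ℂ (Poly E) :=
  Finsupp.lsum ℂ fun p => (p.2 : ℂ) • Finsupp.lsingle (p.1, p.2 - 1)

/-- `A` applied to the coefficients. -/
noncomputable def coeff (A : Module.End ℂ E) : Module.End ℂ (Poly E) :=
  Finsupp.mapRange.linearMap A

@[simp] lemma mulX_single (i j : ℕ) (v : E) :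
    mulX (Finsupp.single (i, j) v) = Finsupp.single (i + 1, j) v := by simp [mulX]

@[simp] lemma mulY_single (i j : ℕ) (v : E) :
    mulY (Finsupp.single (i, j) v) = Finsupp.single (i, j + 1) v := by simp [mulY]

@[simp] lemma derivX_single (i j : ℕ) (v : E) :
    derivX (Finsupp.single (i, j) v) = (i : ℂ) • Finsupp.single (i - 1, j) v := by
  simp [derivX]

@[simp] lemma derivY_single (i j : ℕ) (v : E) :
    derivY (Finsupp.single (i, j) v) = (j : ℂ) • Finsupp.single (i, j - 1) v := by
  simp [derivY]

@[simp] lemma coeff_single (A : Module.End ℂ E) (i j : ℕ) (v : E) :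
    coeff A (Finsupp.single (i, j) v) = Finsupp.single (i, j) (A v) := by simp [coeff]

lemma weylRelations {A B : Module.End ℂ E} (hAB : Commute A B) :
    WeylRelations mulX mulY derivX derivY (coeff A) (coeff B) := by
  have hAB' : ∀ v, A (B v) = B (A v) := fun v => LinearMap.congr_fun hAB v
  constructor <;> refine Finsupp.lhom_ext fun ⟨i, j⟩ v => ?_
  · rcases i with - | i <;> simp
    rw [← Finsupp.smul_single, ← Finsupp.smul_single]
    module
  · rcases j with - | j <;> simp
    rw [← Finsupp.smul_single, ← Finsupp.smul_single]
    module
  iterate 3 · simp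
  · simp [smul_comm (i : ℂ)]
  all_goals simp [hAB']

end DifferentialOperators

/-! ### Verma modules -/

section General

lemma adjoin_range_ι : Algebra.adjoin ℂ (Set.range (ι : Takiff → U)) = ⊤ := by
  rw [eq_top_iff]
  rintro u -
  let S := Algebra.adjoin ℂ (Set.range (ι : Takiff → U))
  let g : Takiff →ₗ⁅ℂ⁆ S :=
    { toFun := fun y => ⟨ι y, Algebra.subset_adjoin ⟨y, rfl⟩⟩
      map_add' := fun a b => by ext; simp
      map_smul' := fun a b => by ext; simp
      map_lie' := fun {a b} => by
        ext
        simp [LieRing.of_associative_ring_bracket] }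
  have e : S.val.comp (UniversalEnvelopingAlgebra.lift ℂ g) = AlgHom.id ℂ _ := by
    ext y
    simp [g]
  have := DFunLike.congr_fun e u
  simp only [AlgHom.comp_apply, AlgHom.id_apply] at this
  rw [← this]
  exact (UniversalEnvelopingAlgebra.lift ℂ g u).2

variable {M N : ModuleCat.{0} U}

lemma ι_lie_smul (x y : Takiff) (v : M) : ι x • ι y • v = ι y • ι x • v + ι ⁅x, y⁆ • v := by
  rw [LieHom.map_lie, Ring.lie_def, sub_smul, mul_smul, mul_smul]
  abel

lemma map_ι_smul_of_generators (φ : M →ₗ[ℂ] N) (v : M) (he : φ (ι e • v) = ι e • φ v)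
    (hh : φ (ι h • v) = ι h • φ v) (hf : φ (ι f • v) = ι f • φ v)
    (he' : φ (ι eBar • v) = ι eBar • φ v) (hh' : φ (ι hBar • v) = ι hBar • φ v)
    (hf' : φ (ι fBar • v) = ι fBar • φ v) (x : Takiff) : φ (ι x • v) = ι x • φ v := by
  have hx : x ∈ Submodule.span ℂ {e, h, f, eBar, hBar, fBar} :=
    span_generators ▸ Submodule.mem_top
  induction hx using Submodule.span_induction with
  | mem x hx =>
    rcases hx with rfl | rfl | rfl | rfl | rfl | rfl
    exacts [he, hh, hf, he', hh', hf']
  | zero => simp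
  | add x y _ _ hx hy => simp only [map_add, add_smul, hx, hy]
  | smul c x _ hx => simp only [map_smul, smul_assoc, hx]

/-- A linear map that commutes with the Lie algebra is a map of modules. -/
noncomputable def homOfMapι (φ : M →ₗ[ℂ] N) (hφ : ∀ (x : Takiff) v, φ (ι x • v) = ι x • φ v) :
    M →ₗ[U] N where
  toFun := φ
  map_add' := φ.map_add
  map_smul' u v := by
    have hu : u ∈ Algebra.adjoin ℂ (Set.range (ι : Takiff → U)) :=
      adjoin_range_ι ▸ Algebra.mem_top
    change φ (u • v) = u • φ v
    induction hu using Algebra.adjoin_induction generalizing v with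
    | mem u hu =>
      obtain ⟨x, rfl⟩ := hu
      exact hφ x v
    | algebraMap c => simp only [algebraMap_smul, map_smul]
    | add a b _ _ ha hb => simp only [add_smul, map_add, ha, hb]
    | mul a b _ _ ha hb => simp only [mul_smul, ha, hb]

/-- A subspace stable under the generators of the Borel subalgebra is stable under it. -/
lemma borel_stable (W : Submodule ℂ M) (hh : ∀ v ∈ W, ι h • v ∈ W)
    (hh' : ∀ v ∈ W, ι hBar • v ∈ W) (he : ∀ v ∈ W, ι e • v ∈ W)
    (he' : ∀ v ∈ W, ι eBar • v ∈ W) : ∀ x ∈ borel, ∀ v ∈ W, act M x v ∈ W := by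
  let K : LieSubalgebra ℂ Takiff :=
    { carrier := {x | ∀ v ∈ W, ι x • v ∈ W}
      add_mem' := fun {x y} hx hy v hv => by
        rw [map_add, add_smul]; exact add_mem (hx v hv) (hy v hv)
      zero_mem' := fun v _ => by rw [map_zero, zero_smul]; exact zero_mem _
      smul_mem' := fun c x hx v hv => by
        rw [map_smul, smul_assoc]; exact W.smul_mem _ (hx v hv)
      lie_mem' := fun {x y} hx hy v hv => by
        rw [LieHom.map_lie, Ring.lie_def, sub_smul, mul_smul, mul_smul]
        exact sub_mem (hx _ (hy v hv)) (hy _ (hx v hv)) }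
  have hK : borel ≤ K := by
    rw [borel, LieSubalgebra.lieSpan_le]
    rintro x (rfl | rfl | rfl | rfl)
    exacts [hh, hh', he, he']
  exact fun x hx v hv => hK hx v hv

end General

section Verma

variable {E : Type} [AddCommGroup E] [Module ℂ E] {A B : Module.End ℂ E}

/-- The Verma module induced from the Borel module `E` on which `h` and `hBar` act by the commuting
endomorphisms `A` and `B`, and `e`, `eBar` by zero. Instead of a tensor product over the enveloping
algebra of the Borel subalgebra, it is defined on `E`-valued polynomials by explicit differential
operators, so that no Poincaré–Birkhoff–Witt theorem is needed. -/
noncomputable def verma (hAB : Commute A B) : ModuleCat.{0} U :=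
  letI : Module U (Poly E) := Module.compHom (Poly E) (UniversalEnvelopingAlgebra.lift ℂ
      (weylRelations hAB).relations.lieHom).toRingHom
  ModuleCat.of U (Poly E)

namespace verma

variable (hAB : Commute A B)

/-- The elements of the Verma module as polynomials with coefficients in `E`. -/
noncomputable def equiv : verma hAB ≃ₗ[ℂ] Poly E where
  toFun p := p
  invFun p := p
  map_add' _ _ := rfl
  map_smul' c p := by
    have h := AlgHom.commutes
      (UniversalEnvelopingAlgebra.lift ℂ (weylRelations hAB).relations.lieHom) c
    exact LinearMap.congr_fun h (p : Poly E)
  left_inv _ := rfl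
  right_inv _ := rfl

lemma equiv_ι (x : Takiff) (p : verma hAB) :
    equiv hAB (ι x • p) = (weylRelations hAB).relations.lieHom x (equiv hAB p) :=
  LinearMap.congr_fun (UniversalEnvelopingAlgebra.lift_ι_apply ℂ
    (weylRelations hAB).relations.lieHom x) (equiv hAB p)

/-- The monomial `fⁱ fBarʲ v`. -/
noncomputable def mon (i j : ℕ) : E →ₗ[ℂ] verma hAB :=
  (equiv hAB).symm.toLinearMap ∘ₗ Finsupp.lsingle (i, j)

@[simp] lemma equiv_mon (i j : ℕ) (v : E) : equiv hAB (mon hAB i j v) = Finsupp.single (i, j) v :=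
  (equiv hAB).apply_symm_apply _

lemma hom_ext {V : Type*} [AddCommGroup V] [Module ℂ V] {φ ψ : verma hAB →ₗ[ℂ] V}
    (H : ∀ i j v, φ (mon hAB i j v) = ψ (mon hAB i j v)) : φ = ψ := by
  have : φ ∘ₗ (equiv hAB).symm.toLinearMap = ψ ∘ₗ (equiv hAB).symm.toLinearMap :=
    Finsupp.lhom_ext fun ⟨i, j⟩ v => H i j v
  ext p
  simpa using LinearMap.congr_fun this (equiv hAB p)

@[simp] lemma f_mon (i j : ℕ) (v : E) : ι f • mon hAB i j v = mon hAB (i + 1) j v := by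
  apply (equiv hAB).injective
  rw [equiv_ι, Relations.lieHom_f]
  simp

@[simp] lemma fBar_mon (i j : ℕ) (v : E) : ι fBar • mon hAB i j v = mon hAB i (j + 1) v := by
  apply (equiv hAB).injective
  rw [equiv_ι, Relations.lieHom_fBar]
  simp

lemma h_mon (i j : ℕ) (v : E) :
    ι h • mon hAB i j v = mon hAB i j (A v) - (2 * (i + j) : ℂ) • mon hAB i j v := by
  apply (equiv hAB).injective
  rw [equiv_ι, Relations.lieHom_h, map_sub, map_smul]
  rcases i with - | i <;> rcases j with - | j <;> simp <;>
    simp only [← Finsupp.smul_single] <;> module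

lemma hBar_mon (i j : ℕ) (v : E) :
    ι hBar • mon hAB i j v = mon hAB i j (B v) - (2 * i : ℂ) • mon hAB (i - 1) (j + 1) v := by
  apply (equiv hAB).injective
  rw [equiv_ι, Relations.lieHom_hBar, map_sub, map_smul]
  simp [smul_smul]

lemma e_mon (i j : ℕ) (v : E) :
    ι e • mon hAB i j v = (i : ℂ) • mon hAB (i - 1) j (A v)
      - (i * (i - 1 + 2 * j) : ℂ) • mon hAB (i - 1) j v
      + (j : ℂ) • mon hAB i (j - 1) (B v) := by
  apply (equiv hAB).injective
  rw [equiv_ι, Relations.lieHom_e, map_add, map_sub, map_smul, map_smul, map_smul]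
  rcases i with - | _ | i <;> rcases j with - | j <;> simp [smul_smul] <;>
    simp only [← Finsupp.smul_single] <;> module

lemma eBar_mon (i j : ℕ) (v : E) :
    ι eBar • mon hAB i j v = (i : ℂ) • mon hAB (i - 1) j (B v)
      - (i * (i - 1) : ℂ) • mon hAB (i - 2) (j + 1) v := by
  apply (equiv hAB).injective
  rw [equiv_ι, Relations.lieHom_eBar, map_sub, map_smul, map_smul]
  rcases i with - | _ | i <;> simp [smul_smul, mul_comm]

end verma
end Verma

/-! ### Singular vectors and the universal property -/

section Coefficients

variable {E : Type*} [AddCommGroup E] [Module ℂ E]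

lemma mulX_apply_zero (p : Poly E) (j : ℕ) : mulX p (0, j) = 0 :=
  Finsupp.mapDomain_of_notMem_range _ _ fun ⟨q, hq⟩ => by simp at hq

lemma mulX_apply_succ (p : Poly E) (i j : ℕ) : mulX p (i + 1, j) = p (i, j) :=
  Finsupp.mapDomain_apply (f := fun q : ℕ × ℕ => (q.1 + 1, q.2))
    (fun q r hqr => by simpa [Prod.ext_iff] using hqr) p (i, j)

lemma mulY_apply_zero (p : Poly E) (i : ℕ) : mulY p (i, 0) = 0 :=
  Finsupp.mapDomain_of_notMem_range _ _ fun ⟨q, hq⟩ => by simp at hq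

lemma mulY_apply_succ (p : Poly E) (i j : ℕ) : mulY p (i, j + 1) = p (i, j) :=
  Finsupp.mapDomain_apply (f := fun q : ℕ × ℕ => (q.1, q.2 + 1))
    (fun q r hqr => by simpa [Prod.ext_iff] using hqr) p (i, j)

lemma derivX_apply (p : Poly E) (i j : ℕ) : derivX p (i, j) = (i + 1 : ℂ) • p (i + 1, j) := by
  induction p using Finsupp.induction_linear with
  | zero => simp
  | add p q hp hq => simp [hp, hq]
  | single q v =>
    obtain ⟨k, l⟩ := q
    rw [derivX_single]
    rcases k with - | k
    · simp
    · by_cases hk : k = i <;> by_cases hl : l = j <;> simp [hk, hl]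

lemma derivY_apply (p : Poly E) (i j : ℕ) : derivY p (i, j) = (j + 1 : ℂ) • p (i, j + 1) := by
  induction p using Finsupp.induction_linear with
  | zero => simp
  | add p q hp hq => simp [hp, hq]
  | single q v =>
    obtain ⟨k, l⟩ := q
    rw [derivY_single]
    rcases l with - | l
    · simp
    · by_cases hk : k = i <;> by_cases hl : l = j <;> simp [hk, hl]

lemma coeff_apply (A : Module.End ℂ E) (p : Poly E) (q : ℕ × ℕ) : coeff A p q = A (p q) := by
  simp [coeff]

end Coefficients

namespace verma

variable {E : Type} [AddCommGroup E] [Module ℂ E] {A B : Module.End ℂ E} (hAB : Commute A B)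

lemma equiv_h (p : verma hAB) (i j : ℕ) : equiv hAB (ι h • p) (i, j) =
    A (equiv hAB p (i, j)) - (2 * (i + j) : ℂ) • equiv hAB p (i, j) := by
  rw [equiv_ι, Relations.lieHom_h]
  rcases i with - | i <;> rcases j with - | j <;>
  simp [coeff_apply, mulX_apply_succ, mulX_apply_zero, mulY_apply_zero, mulY_apply_succ,
    derivX_apply, derivY_apply] <;> module

lemma equiv_hBar_zero (p : verma hAB) (i : ℕ) : equiv hAB (ι hBar • p) (i, 0) =
    B (equiv hAB p (i, 0)) := by
  rw [equiv_ι, Relations.lieHom_hBar]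
  simp [coeff_apply, mulY_apply_zero]

lemma equiv_hBar_succ (p : verma hAB) (i j : ℕ) : equiv hAB (ι hBar • p) (i, j + 1) =
    B (equiv hAB p (i, j + 1)) - (2 * (i + 1) : ℂ) • equiv hAB p (i + 1, j) := by
  rw [equiv_ι, Relations.lieHom_hBar]
  simp [coeff_apply, mulY_apply_succ, derivX_apply, smul_smul]

lemma equiv_eBar_zero (p : verma hAB) (i : ℕ) : equiv hAB (ι eBar • p) (i, 0) =
    (i + 1 : ℂ) • B (equiv hAB p (i + 1, 0)) := by
  rw [equiv_ι, Relations.lieHom_eBar]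
  simp [coeff_apply, mulY_apply_zero, derivX_apply]

lemma equiv_eBar_succ (p : verma hAB) (i j : ℕ) : equiv hAB (ι eBar • p) (i, j + 1) =
    (i + 1 : ℂ) • B (equiv hAB p (i + 1, j + 1)) -
      ((i + 1) * (i + 2) : ℂ) • equiv hAB p (i + 2, j) := by
  rw [equiv_ι, Relations.lieHom_eBar]
  simp [coeff_apply, mulY_apply_succ, derivX_apply, smul_smul]
  module

lemma equiv_e (p : verma hAB) (i j : ℕ) : equiv hAB (ι e • p) (i, j) =
    (i + 1 : ℂ) • A (equiv hAB p (i + 1, j)) -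
      ((i + 1) * (i + 2 * j) : ℂ) • equiv hAB p (i + 1, j) +
      (j + 1 : ℂ) • B (equiv hAB p (i, j + 1)) := by
  rw [equiv_ι, Relations.lieHom_e]
  rcases i with - | i <;> rcases j with - | j <;>
  simp [coeff_apply, mulX_apply_succ, mulX_apply_zero, mulY_apply_zero, mulY_apply_succ,
    derivX_apply, derivY_apply] <;> module

/-- If `hBar` acts injectively on `E`, the vectors killed by `e` and `eBar` lie in degree zero:
the coefficients of `eBar • p = 0`, by induction on `j`, leave only the powers of `fBar`, and
`e • p = 0` then leaves only the constant term. -/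
lemma eq_mon_of_singular (hB : Function.Injective B) {p : verma hAB} (he : ι e • p = 0)
    (he' : ι eBar • p = 0) : p = mon hAB 0 0 (equiv hAB p (0, 0)) := by
  have hpos : ∀ j i, equiv hAB p (i + 1, j) = 0 := by
    intro j
    induction j with
    | zero =>
      intro i
      have := equiv_eBar_zero hAB p i
      rw [he', map_zero, Finsupp.zero_apply, eq_comm,
        smul_eq_zero_iff_right (Nat.cast_add_one_ne_zero i)] at this
      exact hB (this.trans (map_zero B).symm)
    | succ j ih =>
      intro i
      have := equiv_eBar_succ hAB p i j
      rw [he', map_zero, Finsupp.zero_apply, ih (i + 1), smul_zero, sub_zero, eq_comm,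
        smul_eq_zero_iff_right (Nat.cast_add_one_ne_zero i)] at this
      exact hB (this.trans (map_zero B).symm)
  have hzero : ∀ j, equiv hAB p (0, j + 1) = 0 := by
    intro j
    have := equiv_e hAB p 0 j
    rw [he, map_zero, Finsupp.zero_apply, hpos, map_zero, smul_zero, smul_zero, sub_zero, zero_add,
      eq_comm, smul_eq_zero_iff_right (Nat.cast_add_one_ne_zero j)] at this
    exact hB (this.trans (map_zero B).symm)
  apply (equiv hAB).injective
  ext ⟨i, j⟩
  rw [equiv_mon]
  rcases i with - | i
  · rcases j with - | j
    · simp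
    · simp [hzero]
  · simp [hpos]

lemma e_mon_zero (v : E) : ι e • mon hAB 0 0 v = 0 := by rw [e_mon]; simp

lemma eBar_mon_zero (v : E) : ι eBar • mon hAB 0 0 v = 0 := by rw [eBar_mon]; simp

lemma h_mon_zero (v : E) : ι h • mon hAB 0 0 v = mon hAB 0 0 (A v) := by rw [h_mon]; simp

lemma hBar_mon_zero (v : E) : ι hBar • mon hAB 0 0 v = mon hAB 0 0 (B v) := by rw [hBar_mon]; simp

lemma f_pow_mon (k i j : ℕ) (v : E) : ι f ^ k • mon hAB i j v = mon hAB (i + k) j v := by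
  induction k with
  | zero => simp
  | succ k ih => rw [pow_succ', mul_smul, ih, f_mon, add_assoc]

lemma fBar_pow_mon (k i j : ℕ) (v : E) : ι fBar ^ k • mon hAB i j v = mon hAB i (j + k) v := by
  induction k with
  | zero => simp
  | succ k ih => rw [pow_succ', mul_smul, ih, fBar_mon, add_assoc]

lemma smul_mon_zero (i j : ℕ) (v : E) :
    (ι f ^ i * ι fBar ^ j) • mon hAB 0 0 v = mon hAB i j v := by
  rw [mul_smul, fBar_pow_mon, f_pow_mon, zero_add, zero_add]

section UniversalProperty

variable {M : ModuleCat.{0} U}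

lemma ι_fBar_mul_ι_f : ι fBar * ι f = ι f * ι fBar := by
  have := LieHom.map_lie ι fBar f
  rw [lie_fBar_f, map_zero, Ring.lie_def] at this
  exact sub_eq_zero.1 this.symm

/-- The linear map `fⁱ fBarʲ v ↦ fⁱ fBarʲ (θ v)`. -/
noncomputable def liftLinear (θ : E →ₗ[ℂ] M) : verma hAB →ₗ[ℂ] M :=
  (Finsupp.lsum ℂ fun p : ℕ × ℕ => Algebra.lsmul ℂ ℂ M (ι f ^ p.1 * ι fBar ^ p.2) ∘ₗ θ) ∘ₗ
    (equiv hAB).toLinearMap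

lemma liftLinear_mon (θ : E →ₗ[ℂ] M) (i j : ℕ) (v : E) :
    liftLinear hAB θ (mon hAB i j v) = (ι f ^ i * ι fBar ^ j) • θ v := by
  simp only [liftLinear, LinearMap.comp_apply, LinearEquiv.coe_coe, equiv_mon]
  rw [Finsupp.lsum_single]
  rfl

lemma liftLinear_f (θ : E →ₗ[ℂ] M) (p : verma hAB) :
    liftLinear hAB θ (ι f • p) = ι f • liftLinear hAB θ p := by
  have : liftLinear hAB θ ∘ₗ Algebra.lsmul ℂ ℂ (verma hAB) (ι f) =
      Algebra.lsmul ℂ ℂ M (ι f) ∘ₗ liftLinear hAB θ := hom_ext hAB fun i j v => by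
    simp only [LinearMap.comp_apply, Algebra.lsmul_coe, f_mon, liftLinear_mon]
    rw [pow_succ', mul_assoc, mul_smul]
  exact LinearMap.congr_fun this p

lemma liftLinear_fBar (θ : E →ₗ[ℂ] M) (p : verma hAB) :
    liftLinear hAB θ (ι fBar • p) = ι fBar • liftLinear hAB θ p := by
  have : liftLinear hAB θ ∘ₗ Algebra.lsmul ℂ ℂ (verma hAB) (ι fBar) =
      Algebra.lsmul ℂ ℂ M (ι fBar) ∘ₗ liftLinear hAB θ := hom_ext hAB fun i j v => by
    simp only [LinearMap.comp_apply, Algebra.lsmul_coe, fBar_mon, liftLinear_mon]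
    have hc : Commute (ι fBar) (ι f ^ i) := Commute.pow_right ι_fBar_mul_ι_f i
    rw [pow_succ', ← mul_assoc, ← hc.eq, mul_assoc, mul_smul]
  exact LinearMap.congr_fun this p

/-- The universal property of the Verma module: a map of Borel modules from `E` to a module over
the Takiff algebra extends to the Verma module. -/
noncomputable def lift (θ : E →ₗ[ℂ] M) (he : ∀ v, ι e • θ v = 0) (he' : ∀ v, ι eBar • θ v = 0)
    (hh : ∀ v, ι h • θ v = θ (A v)) (hh' : ∀ v, ι hBar • θ v = θ (B v)) : verma hAB →ₗ[U] M :=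
  homOfMapι (liftLinear hAB θ) <| by
    have h0 : ∀ v, liftLinear hAB θ (mon hAB 0 0 v) = θ v := fun v => by simp [liftLinear_mon]
    have hmon : ∀ i j (x : Takiff) v, liftLinear hAB θ (ι x • mon hAB i j v) =
        ι x • liftLinear hAB θ (mon hAB i j v) := by
      intro i j
      induction i with
      | zero =>
        induction j with
        | zero =>
          intro x v
          apply map_ι_smul_of_generators
          · rw [e_mon_zero, map_zero, h0, he]
          · rw [h_mon_zero, h0, h0, hh]
          · rw [liftLinear_f]
          · rw [eBar_mon_zero, map_zero, h0, he']
          · rw [hBar_mon_zero, h0, h0, hh']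
          · rw [liftLinear_fBar]
        | succ j ih =>
          intro x v
          rw [← fBar_mon, ι_lie_smul, map_add, liftLinear_fBar, ih, ih, liftLinear_fBar,
            ← ι_lie_smul]
      | succ i ih =>
        intro x v
        rw [← f_mon, ι_lie_smul, map_add, liftLinear_f, ih, ih, liftLinear_f, ← ι_lie_smul]
    intro x p
    have : liftLinear hAB θ ∘ₗ Algebra.lsmul ℂ ℂ (verma hAB) (ι x) =
        Algebra.lsmul ℂ ℂ M (ι x) ∘ₗ liftLinear hAB θ := hom_ext hAB fun i j v => hmon i j x v
    exact LinearMap.congr_fun this p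

variable (θ : E →ₗ[ℂ] M) (he : ∀ v, ι e • θ v = 0) (he' : ∀ v, ι eBar • θ v = 0)
    (hh : ∀ v, ι h • θ v = θ (A v)) (hh' : ∀ v, ι hBar • θ v = θ (B v))

lemma lift_mon (i j : ℕ) (v : E) : lift hAB θ he he' hh hh' (mon hAB i j v) =
    (ι f ^ i * ι fBar ^ j) • θ v := liftLinear_mon hAB θ i j v

lemma lift_mon_zero (v : E) : lift hAB θ he he' hh hh' (mon hAB 0 0 v) = θ v := by
  simp [lift_mon]

lemma homU_ext {φ ψ : verma hAB →ₗ[U] M} (H : ∀ v, φ (mon hAB 0 0 v) = ψ (mon hAB 0 0 v)) :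
    φ = ψ := by
  have : φ.restrictScalars ℂ = ψ.restrictScalars ℂ := hom_ext hAB fun i j v => by
    simp only [LinearMap.coe_restrictScalars]
    rw [← smul_mon_zero, map_smul, map_smul, H]
  exact LinearMap.restrictScalars_injective ℂ this

end UniversalProperty

section Map

variable {E' : Type} [AddCommGroup E'] [Module ℂ E'] {A' B' : Module.End ℂ E'}
  (hAB' : Commute A' B')

/-- The map of Verma modules induced by a map of Borel modules. -/
noncomputable def map (g : E →ₗ[ℂ] E') (hA : ∀ v, g (A v) = A' (g v))
    (hB : ∀ v, g (B v) = B' (g v)) : verma hAB →ₗ[U] verma hAB' :=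
  lift hAB (mon hAB' 0 0 ∘ₗ g) (fun v => e_mon_zero _ _) (fun v => eBar_mon_zero _ _)
    (fun v => by simp only [LinearMap.comp_apply, hA, h_mon_zero])
    (fun v => by simp only [LinearMap.comp_apply, hB, hBar_mon_zero])

variable (g : E →ₗ[ℂ] E') (hA : ∀ v, g (A v) = A' (g v)) (hB : ∀ v, g (B v) = B' (g v))

lemma map_mon (i j : ℕ) (v : E) :
    map hAB hAB' g hA hB (mon hAB i j v) = mon hAB' i j (g v) := by
  rw [map, lift_mon, LinearMap.comp_apply, smul_mon_zero]

lemma equiv_map (p : verma hAB) (q : ℕ × ℕ) :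
    equiv hAB' (map hAB hAB' g hA hB p) q = g (equiv hAB p q) := by
  have : Finsupp.lapply q ∘ₗ (equiv hAB').toLinearMap ∘ₗ
      (map hAB hAB' g hA hB).restrictScalars ℂ =
      g ∘ₗ Finsupp.lapply q ∘ₗ (equiv hAB).toLinearMap := hom_ext hAB fun i j v => by
    by_cases hq : (i, j) = q <;> simp [map_mon, hq]
  exact LinearMap.congr_fun this p

end Map

end verma

/-! ### Finiteness and simplicity of Verma modules -/

namespace verma

section Degree

variable {E : Type} [AddCommGroup E] [Module ℂ E] {A B : Module.End ℂ E} (hAB : Commute A B)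

/-- The polynomials of degree at most `d`. -/
noncomputable def degLE (d : ℕ) : Submodule ℂ (verma hAB) where
  carrier := {p | ∀ i j, d < i + j → equiv hAB p (i, j) = 0}
  add_mem' hp hq i j hij := by simp [hp i j hij, hq i j hij]
  zero_mem' i j _ := by simp
  smul_mem' c p hp i j hij := by simp [hp i j hij]

lemma exists_mem_degLE (p : verma hAB) : ∃ d, p ∈ degLE hAB d := by
  refine ⟨(equiv hAB p).support.sup fun q => q.1 + q.2, fun i j hij => ?_⟩
  by_contra hne
  exact hij.not_ge (Finset.le_sup (f := fun q : ℕ × ℕ => q.1 + q.2)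
    (Finsupp.mem_support_iff.2 hne))

lemma e_mem_degLE {d : ℕ} {p : verma hAB} (hp : p ∈ degLE hAB (d + 1)) :
    ι e • p ∈ degLE hAB d := fun i j hij => by
  rw [equiv_e, hp (i + 1) j (by omega), hp i (j + 1) (by omega)]
  simp

lemma eBar_mem_degLE {d : ℕ} {p : verma hAB} (hp : p ∈ degLE hAB (d + 1)) :
    ι eBar • p ∈ degLE hAB d := fun i j hij => by
  rcases j with - | j
  · rw [equiv_eBar_zero, hp (i + 1) 0 (by omega)]
    simp
  · rw [equiv_eBar_succ, hp (i + 1) (j + 1) (by omega), hp (i + 2) j (by omega)]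
    simp

lemma h_mem_degLE {d : ℕ} {p : verma hAB} (hp : p ∈ degLE hAB d) :
    ι h • p ∈ degLE hAB d := fun i j hij => by
  rw [equiv_h, hp i j hij]
  simp

lemma hBar_mem_degLE {d : ℕ} {p : verma hAB} (hp : p ∈ degLE hAB d) :
    ι hBar • p ∈ degLE hAB d := fun i j hij => by
  rcases j with - | j
  · rw [equiv_hBar_zero, hp i 0 hij, map_zero]
  · rw [equiv_hBar_succ, hp i (j + 1) hij, hp (i + 1) j (by omega)]
    simp

lemma degLE_mono {c d : ℕ} (hcd : c ≤ d) : degLE hAB c ≤ degLE hAB d :=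
  fun _ hp i j hij => hp i j (by omega)

lemma finite_degLE [Module.Finite ℂ E] (d : ℕ) : Module.Finite ℂ (degLE hAB d) := by
  let g : degLE hAB d →ₗ[ℂ] (Fin (d + 1) × Fin (d + 1) → E) :=
    LinearMap.pi fun q => Finsupp.lapply (q.1.val, q.2.val) ∘ₗ (equiv hAB).toLinearMap ∘ₗ
      (degLE hAB d).subtype
  refine Module.Finite.of_injective g ?_
  rw [injective_iff_map_eq_zero]
  rintro ⟨p, hp⟩ hgp
  apply Subtype.ext
  apply (equiv hAB).injective
  ext ⟨i, j⟩
  by_cases hij : d < i + j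
  · simpa using hp i j hij
  · have h0 : equiv hAB p (i, j) = 0 := congrFun hgp (⟨i, by omega⟩, ⟨j, by omega⟩)
    simpa using h0

lemma borelLocallyFinite [Module.Finite ℂ E] : BorelLocallyFinite (verma hAB) := fun p => by
  obtain ⟨d, hd⟩ := exists_mem_degLE hAB p
  exact ⟨degLE hAB d, finite_degLE hAB d, hd, borel_stable _ (fun _ => h_mem_degLE hAB)
    (fun _ => hBar_mem_degLE hAB)
    (fun q hq => e_mem_degLE hAB (degLE_mono hAB d.le_succ hq))
    (fun q hq => eBar_mem_degLE hAB (degLE_mono hAB d.le_succ hq))⟩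

lemma eq_top_of_mon_mem {N : Submodule ℂ (verma hAB)} (hN : ∀ i j v, mon hAB i j v ∈ N) :
    N = ⊤ := by
  rw [← N.ker_mkQ, LinearMap.ker_eq_top]
  exact hom_ext hAB fun i j v => by simpa using hN i j v

lemma eq_top_of_mon_zero_mem {N : Submodule U (verma hAB)} (hN : ∀ v, mon hAB 0 0 v ∈ N) :
    N = ⊤ := by
  rw [← Submodule.restrictScalars_eq_top_iff ℂ]
  refine eq_top_of_mon_mem hAB fun i j v => ?_
  rw [← smul_mon_zero]
  exact N.smul_mem _ (hN v)

lemma finite [Module.Finite ℂ E] : Module.Finite U (verma hAB) := by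
  obtain ⟨s, hs⟩ := Module.finite_def.1 ‹Module.Finite ℂ E›
  classical
  refine ⟨⟨s.image (mon hAB 0 0), eq_top_of_mon_zero_mem hAB fun v => ?_⟩⟩
  have hv : v ∈ Submodule.span ℂ (s : Set E) := hs ▸ Submodule.mem_top
  have : mon hAB 0 0 v ∈
      Submodule.span ℂ ((s.image (mon hAB 0 0) : Finset _) : Set (verma hAB)) := by
    rw [Finset.coe_image, Submodule.span_image]
    exact ⟨v, hv, rfl⟩
  exact Submodule.span_le_restrictScalars ℂ U _ this

lemma thickO [Module.Finite ℂ E] : thickO (verma hAB) :=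
  ⟨finite hAB, borelLocallyFinite hAB⟩

lemma catO [Module.Finite ℂ E] {a : ℂ} (hA : ∀ v, A v = a • v) : catO (verma hAB) := by
  refine ⟨thickO hAB, eq_top_of_mon_mem hAB fun i j v => ?_⟩
  refine Submodule.mem_iSup_of_mem (a - 2 * (i + j)) ?_
  rw [Module.End.mem_eigenspace_iff, act_apply, h_mon, hA, map_smul, sub_smul]

/-- A nonzero submodule meets degree zero, since `e` and `eBar` lower the degree and a vector killed
by both has degree zero. -/
lemma exists_mon_zero_mem (hB : Function.Injective B) {N : Submodule U (verma hAB)} (hN : N ≠ ⊥) :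
    ∃ v ≠ 0, mon hAB 0 0 v ∈ N := by
  have key : ∀ d, ∀ p ∈ N, p ≠ 0 → p ∈ degLE hAB d → ∃ v ≠ 0, mon hAB 0 0 v ∈ N := by
    intro d
    induction d with
    | zero =>
      intro p hpN hp0 hp
      have hp' : p = mon hAB 0 0 (equiv hAB p (0, 0)) := by
        apply (equiv hAB).injective
        ext ⟨i, j⟩
        by_cases hij : 0 < i + j
        · rw [hp i j hij, equiv_mon, Finsupp.single_eq_of_ne]
          rintro ⟨⟩
          omega
        · obtain ⟨rfl, rfl⟩ : i = 0 ∧ j = 0 := by omega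
          simp
      refine ⟨_, fun h0 => hp0 ?_, hp' ▸ hpN⟩
      rw [hp', h0, map_zero]
    | succ d ih =>
      intro p hpN hp0 hp
      by_cases he : ι e • p = 0
      · by_cases he' : ι eBar • p = 0
        · have hp' := eq_mon_of_singular hAB hB he he'
          refine ⟨_, fun h0 => hp0 ?_, hp' ▸ hpN⟩
          rw [hp', h0, map_zero]
        · exact ih _ (N.smul_mem _ hpN) he' (eBar_mem_degLE hAB hp)
      · exact ih _ (N.smul_mem _ hpN) he (e_mem_degLE hAB hp)
  obtain ⟨p, hpN, hp0⟩ := N.exists_mem_ne_zero_of_ne_bot hN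
  obtain ⟨d, hd⟩ := exists_mem_degLE hAB p
  exact key d p hpN hp0 hd

end Degree
end verma

section Scalar

lemma commute_algebraMap_end (E : Type) [AddCommGroup E] [Module ℂ E] (a b : ℂ) :
    Commute (algebraMap ℂ (Module.End ℂ E) a) (algebraMap ℂ (Module.End ℂ E) b) :=
  Algebra.commute_algebraMap_left _ _

/-- The Verma module with highest weight `h ↦ a`, `hBar ↦ b`. -/
noncomputable abbrev vermaC (a b : ℂ) : ModuleCat.{0} U := verma (commute_algebraMap_end ℂ a b)

namespace vermaC
open verma

variable {a b : ℂ}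

/-- The multiples of the highest weight vector. -/
noncomputable abbrev vec (a b : ℂ) : ℂ →ₗ[ℂ] vermaC a b := mon (commute_algebraMap_end ℂ a b) 0 0

/-- The elements of `vermaC a b` as polynomials. -/
noncomputable abbrev eqv (a b : ℂ) : vermaC a b ≃ₗ[ℂ] Poly ℂ := equiv (commute_algebraMap_end ℂ a b)

lemma h_vec (c : ℂ) : ι h • vec a b c = a • vec a b c := by
  rw [h_mon_zero, Module.algebraMap_end_apply, map_smul]

lemma hBar_vec (c : ℂ) : ι hBar • vec a b c = b • vec a b c := by
  rw [hBar_mon_zero, Module.algebraMap_end_apply, map_smul]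

lemma vec_injective : Function.Injective (vec a b) := fun c d hcd => by
  simpa [vec] using congrArg (fun p => eqv a b p (0, 0)) hcd

lemma algebraMap_end_injective (hb : b ≠ 0) :
    Function.Injective (algebraMap ℂ (Module.End ℂ ℂ) b) := fun c d hcd => by
  simpa [hb] using hcd

lemma exists_eq_vec (hb : b ≠ 0) {p : vermaC a b} (he : ι e • p = 0) (he' : ι eBar • p = 0) :
    ∃ c, p = vec a b c :=
  ⟨_, eq_mon_of_singular _ (algebraMap_end_injective hb) he he'⟩

lemma isSimpleModule (hb : b ≠ 0) : IsSimpleModule U (vermaC a b) := by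
  rw [isSimpleModule_iff]
  have : Nontrivial (Submodule U (vermaC a b)) := by
    rw [Submodule.nontrivial_iff]
    exact (vec_injective (a := a) (b := b)).nontrivial
  refine { eq_bot_or_eq_top := fun N => or_iff_not_imp_left.2 fun hN => ?_ }
  obtain ⟨c, hc, hcN⟩ := exists_mon_zero_mem _ (algebraMap_end_injective hb) hN
  refine eq_top_of_mon_zero_mem _ fun v => ?_
  have : v = (v / c) • c := by simp [hc]
  rw [this, map_smul]
  exact N.smul_of_tower_mem _ hcN

lemma eqv_h (p : vermaC a b) (i j : ℕ) :
    eqv a b (ι h • p) (i, j) = (a - 2 * (i + j)) * eqv a b p (i, j) := by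
  rw [equiv_h, Module.algebraMap_end_apply, smul_eq_mul, smul_eq_mul, sub_mul]

lemma eq_zero_of_h_smul {p : vermaC a b} (hp : ι h • p = (a + 2) • p) : p = 0 := by
  apply (eqv a b).injective
  ext ⟨i, j⟩
  have h1 := eqv_h p i j
  rw [hp, map_smul, Finsupp.smul_apply, smul_eq_mul] at h1
  have h2 : ((2 : ℂ) * ((i + j + 1 : ℕ) : ℂ)) * eqv a b p (i, j) = 0 := by
    push_cast
    linear_combination h1
  rcases mul_eq_zero.1 h2 with h3 | h3
  · exact absurd h3 (mul_ne_zero two_ne_zero (Nat.cast_ne_zero.2 (by omega)))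
  · simpa using h3

lemma exists_eq_vec_of_h_smul {p : vermaC a b} (hp : ι h • p = a • p) : ∃ c, p = vec a b c := by
  refine ⟨eqv a b p (0, 0), (eqv a b).injective ?_⟩
  ext ⟨i, j⟩
  rw [equiv_mon]
  by_cases hij : 0 < i + j
  · have h1 := eqv_h p i j
    rw [hp, map_smul, Finsupp.smul_apply, smul_eq_mul] at h1
    have h2 : ((2 : ℂ) * ((i + j : ℕ) : ℂ)) * eqv a b p (i, j) = 0 := by
      push_cast
      linear_combination h1
    rcases mul_eq_zero.1 h2 with h3 | h3
    · exact absurd h3 (mul_ne_zero two_ne_zero (Nat.cast_ne_zero.2 (by omega)))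
    · rw [h3, Finsupp.single_eq_of_ne]
      rintro ⟨⟩
      omega
  · obtain ⟨rfl, rfl⟩ : i = 0 ∧ j = 0 := by omega
    simp

/-- Every vector is in the image of `h - a` up to a highest weight vector, as `h - a` is
invertible on the other weight spaces. -/
lemma exists_sub_eq_vec (p : vermaC a b) : ∃ q c, p = (ι h • q - a • q) + vec a b c := by
  have htop : LinearMap.range (act (vermaC a b) h - a • LinearMap.id) ⊔
      LinearMap.range (vec a b) = ⊤ := by
    refine eq_top_of_mon_mem _ fun i j v => ?_
    by_cases hij : i = 0 ∧ j = 0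
    · obtain ⟨rfl, rfl⟩ := hij
      exact Submodule.mem_sup_right ⟨v, rfl⟩
    · refine Submodule.mem_sup_left ⟨(-(2 * (i + j : ℂ))⁻¹) • mon _ i j v, ?_⟩
      have hne : (2 * (i + j : ℂ)) ≠ 0 := by
        refine mul_ne_zero two_ne_zero ?_
        rw [← Nat.cast_add, Nat.cast_ne_zero]
        omega
      rw [map_smul, LinearMap.sub_apply, act_apply, h_mon, Module.algebraMap_end_apply, map_smul,
        LinearMap.smul_apply, LinearMap.id_apply, sub_sub_cancel_left, smul_neg, neg_smul, neg_neg,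
        smul_smul, inv_mul_cancel₀ hne, one_smul]
  have hp : p ∈ LinearMap.range (act (vermaC a b) h - a • LinearMap.id) ⊔
      LinearMap.range (vec a b) := htop ▸ Submodule.mem_top
  obtain ⟨_, ⟨q, rfl⟩, _, ⟨c, rfl⟩, rfl⟩ := Submodule.mem_sup.1 hp
  exact ⟨q, c, rfl⟩

end vermaC
end Scalar

/-! ### Supports and subquotients -/

section Weights

lemma cartan_eq_span (x : cartan) : x ∈ Submodule.span ℂ {cartanH, cartanHBar} := by
  have htmul : ∀ x ∈ Submodule.span ℂ {h, hBar}, ∃ s : DualNumber ℂ, x = s ⊗ₜ slH := by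
    intro x hx
    obtain ⟨c, d, rfl⟩ := Submodule.mem_span_pair.1 hx
    exact ⟨c • 1 + d • DualNumber.eps, by
      simp only [h, hBar, TensorProduct.add_tmul, TensorProduct.smul_tmul']⟩
  let K : LieSubalgebra ℂ Takiff :=
    { Submodule.span ℂ {h, hBar} with
      lie_mem' := fun {x y} hx hy => by
        obtain ⟨s, rfl⟩ := htmul x hx
        obtain ⟨t, rfl⟩ := htmul y hy
        rw [LieAlgebra.ExtendScalars.bracket_tmul, lie_self, TensorProduct.tmul_zero]
        exact Submodule.zero_mem _ }
  have hK : cartan ≤ K := by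
    rw [cartan, LieSubalgebra.lieSpan_le]
    exact Submodule.subset_span
  obtain ⟨c, d, hcd⟩ := Submodule.mem_span_pair.1 (hK x.2)
  exact Submodule.mem_span_pair.2 ⟨c, d, Subtype.ext hcd⟩

lemma weight_ext {μ ν : Weight} (h1 : μ cartanH = ν cartanH)
    (h2 : μ cartanHBar = ν cartanHBar) : μ = ν := by
  refine LinearMap.ext fun x => ?_
  obtain ⟨c, d, rfl⟩ := Submodule.mem_span_pair.1 (cartan_eq_span x)
  simp [h1, h2]

lemma support_subset_of_injective {M N : ModuleCat.{0} U} (g : M →ₗ[U] N)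
    (hg : Function.Injective g) : support M ⊆ support N := by
  intro ν hν
  obtain ⟨v, hv, hv0⟩ := (Submodule.ne_bot_iff _).1 hν
  have hpow : ∀ (x : Takiff) (c : ℂ) (k : ℕ) (v : M),
      g (((act M x - c • 1) ^ k) v) = ((act N x - c • 1) ^ k) (g v) := by
    intro x c k
    induction k with
    | zero => simp
    | succ k ih =>
      intro v
      rw [pow_succ, pow_succ, Module.End.mul_apply, Module.End.mul_apply, ih]
      congr 1
      change g (ι x • v - c • v) = ι x • g v - c • g v
      rw [map_sub, map_smul, LinearMap.map_smul_of_tower]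
  refine (Submodule.ne_bot_iff _).2 ⟨g v, ⟨?_, ?_⟩, fun h0 => hv0 (hg (h0.trans (map_zero g).symm))⟩
  · obtain ⟨k, hk⟩ := Module.End.mem_maxGenEigenspace _ _ _ |>.1 hv.1
    exact Module.End.mem_maxGenEigenspace _ _ _ |>.2 ⟨k, by rw [← hpow, hk, map_zero]⟩
  · obtain ⟨k, hk⟩ := Module.End.mem_maxGenEigenspace _ _ _ |>.1 hv.2
    exact Module.End.mem_maxGenEigenspace _ _ _ |>.2 ⟨k, by rw [← hpow, hk, map_zero]⟩

lemma support_congr {M N : ModuleCat.{0} U} (g : M ≃ₗ[U] N) : support M = support N :=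
  (support_subset_of_injective g.toLinearMap g.injective).antisymm
    (support_subset_of_injective g.symm.toLinearMap g.symm.injective)

namespace vermaC
open verma

lemma support_eq (μ : Weight) :
    support (vermaC (μ cartanH) (μ cartanHBar)) = {ν | ∃ n : ℕ, ν = μ - n • root} := by
  generalize ha : μ cartanH = a
  generalize hb : μ cartanHBar = b
  ext ν
  constructor
  · intro hν
    obtain ⟨v, ⟨hv, hv'⟩, hv0⟩ := (Submodule.ne_bot_iff _).1 hν
    obtain ⟨k, hk⟩ := Module.End.mem_maxGenEigenspace _ _ _ |>.1 hv
    obtain ⟨l, hl⟩ := Module.End.mem_maxGenEigenspace _ _ _ |>.1 hv'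
    have h1 : ∃ n : ℕ, ν cartanH = a - 2 * n := by
      have hpow : ∀ (k : ℕ) (p : vermaC a b) i j,
          eqv a b (((act (vermaC a b) h - ν cartanH • 1) ^ k) p) (i, j) =
            (a - 2 * (i + j) - ν cartanH) ^ k * eqv a b p (i, j) := by
        intro k
        induction k with
        | zero => simp
        | succ k ih =>
          intro p i j
          rw [pow_succ, Module.End.mul_apply, ih]
          have : eqv a b ((act (vermaC a b) h - ν cartanH • 1) p) (i, j) =
              (a - 2 * (i + j) - ν cartanH) * eqv a b p (i, j) := by
            change eqv a b (ι h • p - ν cartanH • p) (i, j) = _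
            rw [map_sub, map_smul (eqv a b) (ν cartanH), Finsupp.sub_apply, eqv_h,
              Finsupp.smul_apply, smul_eq_mul]
            ring
          rw [this]
          ring
      by_contra! hne
      apply hv0
      apply (eqv a b).injective
      ext ⟨i, j⟩
      have h2 := hpow k v i j
      rw [hk, map_zero, Finsupp.zero_apply, eq_comm] at h2
      have hne' : a - 2 * (i + j) - ν cartanH ≠ 0 := fun h3 => hne (i + j) (by
        push_cast
        linear_combination -h3)
      simpa using (mul_eq_zero.1 h2).resolve_left (pow_ne_zero k hne')
    have h2 : ν cartanHBar = b := by
      by_contra hne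
      have hinj : Function.Injective
          (act (vermaC a b) hBar - ν cartanHBar • 1 : Module.End ℂ (vermaC a b)) := by
        rw [injective_iff_map_eq_zero]
        intro p hp
        replace hp : ι hBar • p - ν cartanHBar • p = 0 := hp
        have hne' : b - ν cartanHBar ≠ 0 := sub_ne_zero.2 (Ne.symm hne)
        have hz : ∀ j i, eqv a b p (i, j) = 0 := by
          intro j
          induction j with
          | zero =>
            intro i
            have h3 := congrArg (fun p => eqv a b p (i, 0)) hp
            simp only [map_sub, map_smul, Finsupp.sub_apply, Finsupp.smul_apply, equiv_hBar_zero,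
              Module.algebraMap_end_apply, smul_eq_mul, map_zero, Finsupp.zero_apply,
              ← sub_mul] at h3
            exact (mul_eq_zero.1 h3).resolve_left hne'
          | succ j ih =>
            intro i
            have h3 := congrArg (fun p => eqv a b p (i, j + 1)) hp
            simp only [map_sub, map_smul, Finsupp.sub_apply, Finsupp.smul_apply, equiv_hBar_succ,
              Module.algebraMap_end_apply, smul_eq_mul, map_zero, Finsupp.zero_apply, ih, mul_zero,
              sub_zero, ← sub_mul] at h3
            exact (mul_eq_zero.1 h3).resolve_left hne'
        apply (eqv a b).injective
        ext ⟨i, j⟩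
        simp [hz]
      have hinj' : Function.Injective
          ((act (vermaC a b) hBar - ν cartanHBar • 1 : Module.End ℂ (vermaC a b)) ^ l) := by
        rw [Module.End.coe_pow]
        exact hinj.iterate l
      exact hv0 (hinj' (hl.trans (map_zero _).symm))
    obtain ⟨n, hn⟩ := h1
    refine ⟨n, weight_ext ?_ ?_⟩
    · rw [hn, LinearMap.sub_apply, LinearMap.smul_apply, root_cartanH, ha, nsmul_eq_mul, mul_comm]
    · rw [h2, LinearMap.sub_apply, LinearMap.smul_apply, root_cartanHBar, hb, smul_zero, sub_zero]
  · rintro ⟨n, rfl⟩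
    refine (Submodule.ne_bot_iff _).2 ⟨mon _ 0 n 1, ⟨?_, ?_⟩, fun h0 => ?_⟩
    · refine Module.End.mem_maxGenEigenspace _ _ _ |>.2 ⟨1, ?_⟩
      rw [pow_one, LinearMap.sub_apply, LinearMap.smul_apply, Module.End.one_apply, act_apply,
        h_mon, LinearMap.sub_apply, LinearMap.smul_apply, root_cartanH, ha,
        Module.algebraMap_end_apply, map_smul, nsmul_eq_mul]
      push_cast
      module
    · refine Module.End.mem_maxGenEigenspace _ _ _ |>.2 ⟨1, ?_⟩
      rw [pow_one, LinearMap.sub_apply, LinearMap.smul_apply, Module.End.one_apply, act_apply,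
        hBar_mon, LinearMap.sub_apply, LinearMap.smul_apply, root_cartanHBar, hb,
        Module.algebraMap_end_apply, map_smul]
      simp
    · simpa using congrArg (fun p => eqv a b p (0, n)) h0

end vermaC

end Weights

section Blocks

/-- Every simple subquotient of `M` has support `{μ - n α : n = 0, 1, 2, …}`. -/
def SimpleSupport (μ : Weight) (M : ModuleCat.{0} U) : Prop :=
  ∀ S : ModuleCat.{0} U, IsSubquotient S M → Simple S →
    support S = {ν | ∃ n : ℕ, ν = μ - n • root}

lemma nonempty_equiv_of_isSubquotient {S M : ModuleCat.{0} U} (hM : IsSimpleModule U M)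
    (hS : Simple S) (h : IsSubquotient S M) : Nonempty (M ≃ₗ[U] S) := by
  have hS' : IsSimpleModule U S := simple_iff_isSimpleModule.1 hS
  obtain ⟨N, p, hp⟩ := h
  have := IsSimpleModule.nontrivial U S
  rcases eq_bot_or_eq_top N with rfl | rfl
  · obtain ⟨s, hs⟩ := exists_ne (0 : S)
    obtain ⟨x, rfl⟩ := hp s
    rw [Subsingleton.elim x 0, map_zero] at hs
    exact absurd rfl hs
  · have hq : Function.Surjective (p ∘ₗ Submodule.topEquiv.symm.toLinearMap) :=
      hp.comp Submodule.topEquiv.symm.surjective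
    have hq0 : p ∘ₗ Submodule.topEquiv.symm.toLinearMap ≠ 0 := fun h0 => by
      obtain ⟨s, hs⟩ := exists_ne (0 : S)
      obtain ⟨x, rfl⟩ := hq s
      rw [h0] at hs
      exact hs rfl
    exact ⟨LinearEquiv.ofBijective _ (LinearMap.bijective_of_ne_zero hq0)⟩

lemma IsSubquotient.of_exact {S K P L : ModuleCat.{0} U} (hS' : Simple S) (i : K →ₗ[U] P)
    (g : P →ₗ[U] L) (hex : LinearMap.ker g ≤ LinearMap.range i) (hS : IsSubquotient S P) :
    IsSubquotient S K ∨ IsSubquotient S L := by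
  have hsimple : IsSimpleModule U S := simple_iff_isSimpleModule.1 hS'
  obtain ⟨N, p, hp⟩ := hS
  let q : N →ₗ[U] L := g ∘ₗ N.subtype
  rcases eq_bot_or_eq_top ((LinearMap.ker q).map p) with h0 | h1
  · right
    have hle : LinearMap.ker q ≤ LinearMap.ker p := fun k hk => by
      have : p k ∈ (LinearMap.ker q).map p := ⟨k, hk, rfl⟩
      rw [h0] at this
      exact this
    let t : (N ⧸ LinearMap.ker q) →ₗ[U] S := (LinearMap.ker q).liftQ p hle
    refine ⟨LinearMap.range q, t ∘ₗ q.quotKerEquivRange.symm.toLinearMap, fun s => ?_⟩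
    obtain ⟨k, rfl⟩ := hp s
    refine ⟨q.quotKerEquivRange (Submodule.Quotient.mk k), ?_⟩
    rw [LinearMap.comp_apply, LinearEquiv.coe_coe, LinearEquiv.symm_apply_apply]
    exact Submodule.liftQ_apply _ _ _
  · left
    refine ⟨N.comap i, p ∘ₗ i.restrict (p := N.comap i) (q := N) fun _ h => h, fun s => ?_⟩
    have : s ∈ (LinearMap.ker q).map p := h1 ▸ Submodule.mem_top
    obtain ⟨⟨k, hkN⟩, hk, rfl⟩ := this
    obtain ⟨x, rfl⟩ := hex hk
    exact ⟨⟨x, hkN⟩, rfl⟩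

lemma SimpleSupport.of_exact {μ : Weight} {K P L : ModuleCat.{0} U} (hK : SimpleSupport μ K)
    (hL : SimpleSupport μ L) (i : K →ₗ[U] P) (g : P →ₗ[U] L)
    (hex : LinearMap.ker g ≤ LinearMap.range i) : SimpleSupport μ P := fun S hS hS' =>
  (hS.of_exact hS' i g hex).elim (fun h => hK S h hS') (fun h => hL S h hS')

lemma SimpleSupport.vermaC {μ : Weight} (hμ : μ cartanHBar ≠ 0) :
    SimpleSupport μ (vermaC (μ cartanH) (μ cartanHBar)) := fun S hS hS' => by
  obtain ⟨g⟩ := nonempty_equiv_of_isSubquotient (vermaC.isSimpleModule hμ) hS' hS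
  rw [← support_congr g, vermaC.support_eq]

lemma ClosedProp.pi {P : ObjectProperty (ModuleCat.{0} U)} (hP : ClosedProp P)
    {M : ModuleCat.{0} U} (hM : P M) (n : ℕ) : P (ModuleCat.of U (Fin n → M)) := by
  induction n with
  | zero =>
    exact hP.inj (M := ModuleCat.of U (Fin 0 → M)) (N := ModuleCat.of U PUnit)
      (0 : (Fin 0 → M) →ₗ[U] PUnit)
      (fun a b _ => Subsingleton.elim (α := Fin 0 → M) a b) hP.zero
  | succ n ih =>
    exact hP.inj (M := ModuleCat.of U (Fin (n + 1) → M)) (N := ModuleCat.of U (M × (Fin n → M)))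
      ((LinearMap.proj 0).prod (LinearMap.funLeft U M Fin.succ) : (Fin (n + 1) → M) →ₗ[U] _)
      (fun a b hab => funext fun i => Fin.cases (congrArg Prod.fst hab)
        (fun i => congrFun (congrArg Prod.snd hab) i) i) (hP.prod hM ih)

end Blocks

/-! ### The simple objects of a block -/

section GeneralizedEigenspaces

variable {V : Type*} [AddCommGroup V] [Module ℂ V] (T X Y : Module.End ℂ V) {c d : ℂ}

lemma pow_sub_apply (hX : ∀ v, T (X v) = X (T v) + d • X v) (k : ℕ) (v : V) :
    ((T - (c + d) • 1) ^ k) (X v) = X (((T - c • 1) ^ k) v) := by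
  induction k generalizing v with
  | zero => simp
  | succ k ih =>
    have : (T - (c + d) • 1) (X v) = X ((T - c • 1) v) := by
      simp only [LinearMap.sub_apply, LinearMap.smul_apply, Module.End.one_apply, hX, map_sub,
        map_smul]
      module
    rw [pow_succ, pow_succ, Module.End.mul_apply, Module.End.mul_apply, this, ih]

lemma apply_mem_maxGenEigenspace (hX : ∀ v, T (X v) = X (T v) + d • X v) {v : V}
    (hv : v ∈ T.maxGenEigenspace c) : X v ∈ T.maxGenEigenspace (c + d) := by
  obtain ⟨k, hk⟩ := Module.End.mem_maxGenEigenspace _ _ _ |>.1 hv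
  exact Module.End.mem_maxGenEigenspace _ _ _ |>.2 ⟨k, by rw [pow_sub_apply T X hX, hk, map_zero]⟩

/-- An operator that commutes with `T` up to an operator commuting with `T` preserves the
generalized eigenspaces of `T`. -/
lemma apply_mem_maxGenEigenspace_of_step (hX : ∀ v, T (X v) = X (T v) + Y v)
    (hY : ∀ v, T (Y v) = Y (T v)) {v : V} (hv : v ∈ T.maxGenEigenspace c) :
    X v ∈ T.maxGenEigenspace c := by
  obtain ⟨k, hk⟩ := Module.End.mem_maxGenEigenspace _ _ _ |>.1 hv
  refine Module.End.mem_maxGenEigenspace _ _ _ |>.2 ⟨k + 1, ?_⟩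
  have hY' : ∀ (k : ℕ) (v : V), ((T - c • 1) ^ k) (Y v) = Y (((T - c • 1) ^ k) v) := fun k v => by
    simpa using pow_sub_apply T Y (c := c) (d := 0) (by simpa using hY) k v
  have hX' : ∀ v, (T - c • 1) (X v) = X ((T - c • 1) v) + Y v := fun v => by
    simp only [LinearMap.sub_apply, LinearMap.smul_apply, Module.End.one_apply, hX, map_sub,
      map_smul]
    module
  clear hv
  induction k generalizing v with
  | zero =>
    rw [pow_zero, Module.End.one_apply] at hk
    rw [hk, map_zero, map_zero]
  | succ k ih =>
    rw [pow_succ, Module.End.mul_apply, hX', map_add, hY', hk, map_zero, add_zero]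
    rw [pow_succ, Module.End.mul_apply] at hk
    exact ih hk

end GeneralizedEigenspaces

section SimpleObjects

variable {M : ModuleCat.{0} U}

lemma ι_hBar_h (v : M) : ι hBar • ι h • v = ι h • ι hBar • v := by
  have := ι_lie_smul h hBar v
  rw [lie_h_hBar, map_zero, zero_smul, add_zero] at this
  exact this.symm

lemma ι_h_e (v : M) : ι h • ι e • v = ι e • ι h • v + (2 : ℂ) • ι e • v := by
  rw [ι_lie_smul, lie_h_e, map_smul, smul_assoc]

lemma ι_h_eBar (v : M) : ι h • ι eBar • v = ι eBar • ι h • v + (2 : ℂ) • ι eBar • v := by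
  rw [ι_lie_smul, lie_h_eBar, map_smul, smul_assoc]

lemma ι_hBar_eBar (v : M) : ι hBar • ι eBar • v = ι eBar • ι hBar • v := by
  have := ι_lie_smul hBar eBar v
  rwa [lie_hBar_eBar, map_zero, zero_smul, add_zero] at this

lemma ι_hBar_e (v : M) : ι hBar • ι e • v = ι e • ι hBar • v + (2 : ℂ) • ι eBar • v := by
  rw [ι_lie_smul, lie_hBar_e, map_smul, smul_assoc]

lemma eBar_mem_weightSpace {μ : Weight} {v : M} (hv : v ∈ weightSpace M μ) :
    ι eBar • v ∈ weightSpace M (μ + root) := by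
  refine ⟨?_, ?_⟩
  · rw [LinearMap.add_apply, root_cartanH]
    exact apply_mem_maxGenEigenspace (act M h) (act M eBar) ι_h_eBar hv.1
  · rw [LinearMap.add_apply, root_cartanHBar]
    exact apply_mem_maxGenEigenspace (act M hBar) (act M eBar) (d := 0)
      (fun w => by rw [zero_smul, add_zero]; exact ι_hBar_eBar w) hv.2

lemma e_mem_weightSpace {μ : Weight} {v : M} (hv : v ∈ weightSpace M μ) :
    ι e • v ∈ weightSpace M (μ + root) := by
  refine ⟨?_, ?_⟩
  · rw [LinearMap.add_apply, root_cartanH]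
    exact apply_mem_maxGenEigenspace (act M h) (act M e) ι_h_e hv.1
  · rw [LinearMap.add_apply, root_cartanHBar, add_zero]
    refine apply_mem_maxGenEigenspace_of_step (act M hBar) (act M e) ((2 : ℂ) • act M eBar)
      (fun w => ?_) (fun w => ?_) hv.2
    · rw [LinearMap.smul_apply]
      exact ι_hBar_e w
    · rw [LinearMap.smul_apply, LinearMap.smul_apply, map_smul]
      exact congrArg ((2 : ℂ) • ·) (ι_hBar_eBar w)

lemma exists_pow_ne_zero {V : Type*} [AddCommGroup V] [Module ℂ V] (T : Module.End ℂ V) {v : V}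
    (hv : v ≠ 0) {k : ℕ} (hk : (T ^ k) v = 0) : ∃ l, (T ^ l) v ≠ 0 ∧ T ((T ^ l) v) = 0 := by
  induction k with
  | zero => exact absurd hk hv
  | succ k ih =>
    by_cases h0 : (T ^ k) v = 0
    · exact ih h0
    · exact ⟨k, h0, by rwa [← Module.End.mul_apply, ← pow_succ']⟩

/-- If `μ` is a weight and `μ + α` is not, there is a highest weight vector of weight `μ`: a common
eigenvector of `h` and `hBar` in the generalized weight space, which `e` and `eBar` map to
the generalized weight space of `μ + α`. -/
lemma exists_highest_weight_vector {μ : Weight} (hμ : μ ∈ support M)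
    (hμ' : μ + root ∉ support M) : ∃ v : M, v ≠ 0 ∧ ι e • v = 0 ∧ ι eBar • v = 0 ∧
      ι h • v = μ cartanH • v ∧ ι hBar • v = μ cartanHBar • v := by
  have hbot : weightSpace M (μ + root) = ⊥ := not_not.1 hμ'
  obtain ⟨v, ⟨hv, hv'⟩, hv0⟩ := (Submodule.ne_bot_iff _).1 hμ
  obtain ⟨k, hk⟩ := Module.End.mem_maxGenEigenspace _ _ _ |>.1 hv
  obtain ⟨l, hl⟩ := Module.End.mem_maxGenEigenspace _ _ _ |>.1 hv'
  have hcomm : Commute (act M h - μ cartanH • 1) (act M hBar - μ cartanHBar • 1) := by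
    have : Commute (act M h) (act M hBar) := LinearMap.ext fun w => (ι_hBar_h w).symm
    exact ((this.sub_left (Algebra.commute_algebraMap_left (μ cartanH) _)).sub_right
      (Algebra.commute_algebraMap_right (μ cartanHBar) _))
  obtain ⟨m, hm0, hm⟩ := exists_pow_ne_zero _ hv0 hk
  set w := ((act M h - μ cartanH • 1) ^ m) v with hw
  have hlw : ((act M hBar - μ cartanHBar • 1) ^ l) w = 0 := by
    have := (hcomm.pow_pow m l).eq
    rw [hw, ← Module.End.mul_apply, ← this, Module.End.mul_apply, hl, map_zero]
  obtain ⟨n, hn0, hn⟩ := exists_pow_ne_zero _ hm0 hlw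
  set u := ((act M hBar - μ cartanHBar • 1) ^ n) w with hu
  have hhu : (act M h - μ cartanH • 1) u = 0 := by
    have := (hcomm.pow_right n).eq
    rw [hu, ← Module.End.mul_apply, this, Module.End.mul_apply, hm, map_zero]
  have huW : u ∈ weightSpace M μ :=
    ⟨Module.End.mem_maxGenEigenspace _ _ _ |>.2 ⟨1, by rwa [pow_one]⟩,
      Module.End.mem_maxGenEigenspace _ _ _ |>.2 ⟨1, by rwa [pow_one]⟩⟩
  refine ⟨u, hn0, ?_, ?_, sub_eq_zero.1 hhu, sub_eq_zero.1 hn⟩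
  · exact (Submodule.mem_bot ℂ).1 (hbot ▸ e_mem_weightSpace huW)
  · exact (Submodule.mem_bot ℂ).1 (hbot ▸ eBar_mem_weightSpace huW)

/-- The simple modules of the block are Verma modules, by the universal property. -/
lemma nonempty_vermaC_equiv {μ : Weight} (hμ : μ cartanHBar ≠ 0) (hM : IsSimpleModule U M)
    (hsupp : support M = {ν | ∃ n : ℕ, ν = μ - n • root}) :
    Nonempty (vermaC (μ cartanH) (μ cartanHBar) ≃ₗ[U] M) := by
  obtain ⟨v, hv0, he, he', hh, hh'⟩ := exists_highest_weight_vector (M := M) (μ := μ)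
    (by rw [hsupp]; exact ⟨0, by simp⟩) (by
      rw [hsupp]
      rintro ⟨n, hn⟩
      have h1 := LinearMap.congr_fun hn cartanH
      rw [LinearMap.add_apply, LinearMap.sub_apply, LinearMap.smul_apply, root_cartanH,
        nsmul_eq_mul] at h1
      have h2 : (2 : ℂ) * ((n + 1 : ℕ) : ℂ) = 0 := by
        push_cast
        linear_combination h1
      exact mul_ne_zero two_ne_zero (Nat.cast_ne_zero.2 n.succ_ne_zero) h2)
  let θ : ℂ →ₗ[ℂ] M := LinearMap.toSpanSingleton ℂ M v
  have hθ : ∀ c, θ c = c • v := fun c => rfl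
  let φ := verma.lift (commute_algebraMap_end ℂ (μ cartanH) (μ cartanHBar)) θ
    (fun c => by rw [hθ, smul_comm, he, smul_zero])
    (fun c => by rw [hθ, smul_comm, he', smul_zero])
    (fun c => by rw [hθ, hθ, smul_comm, hh, smul_smul, Module.algebraMap_end_apply, smul_eq_mul,
      mul_comm])
    (fun c => by rw [hθ, hθ, smul_comm, hh', smul_smul, Module.algebraMap_end_apply, smul_eq_mul,
      mul_comm])
  have hφ : φ ≠ 0 := fun h0 => by
    have h1 : φ (vermaC.vec _ _ 1) = θ 1 := verma.lift_mon_zero _ _ _ _ _ _ _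
    rw [h0, hθ, one_smul] at h1
    exact hv0 h1.symm
  have := vermaC.isSimpleModule (a := μ cartanH) hμ
  exact ⟨LinearEquiv.ofBijective φ (LinearMap.bijective_of_ne_zero hφ)⟩

end SimpleObjects

/-! ### Self-extensions of a Verma module -/

section Extension

variable {W : Type} [AddCommGroup W] [Module ℂ W]

/-- The endomorphism `(z, u) ↦ (a z, a u + z α)` of `ℂ × W`: the scalar `a`, deformed by sending
the first basis vector to `α ∈ W`. -/
noncomputable def extEnd (a : ℂ) (α : W) : Module.End ℂ (ℂ × W) :=
  algebraMap ℂ _ a + LinearMap.inr ℂ ℂ W ∘ₗ LinearMap.toSpanSingleton ℂ W α ∘ₗ LinearMap.fst ℂ ℂ W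

lemma extEnd_apply (a : ℂ) (α : W) (w : ℂ × W) :
    extEnd a α w = (a * w.1, a • w.2 + w.1 • α) := by
  obtain ⟨z, u⟩ := w
  simp [extEnd]

lemma commute_extEnd (a b : ℂ) (α β : W) : Commute (extEnd a α) (extEnd b β) :=
  LinearMap.ext fun w => by
    simp only [Module.End.mul_apply, extEnd_apply]
    refine Prod.ext ?_ ?_
    · simp only
      ring
    · simp only
      module

lemma inr_algebraMap_end (a : ℂ) (α : W) (u : W) :
    LinearMap.inr ℂ ℂ W (algebraMap ℂ (Module.End ℂ W) a u) =
      extEnd a α (LinearMap.inr ℂ ℂ W u) := by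
  simp [extEnd_apply]

lemma fst_extEnd (a : ℂ) (α : W) (w : ℂ × W) : LinearMap.fst ℂ ℂ W (extEnd a α w) =
    algebraMap ℂ (Module.End ℂ ℂ) a (LinearMap.fst ℂ ℂ W w) := by
  simp [extEnd_apply]

/-- The Verma module induced from `ℂ × W`, with `h` acting by `extEnd a α` and `hBar` by
`extEnd b β`. It is an extension of `vermaC a b` by the Verma module of scalar weight on `W`. -/
noncomputable abbrev vermaExt (a b : ℂ) (α β : W) : ModuleCat.{0} U :=
  verma (commute_extEnd a b α β)

namespace vermaExt

/-- The inclusion of the Verma module induced from `W`. -/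
noncomputable def incl (a b : ℂ) (α β : W) :
    verma (commute_algebraMap_end W a b) →ₗ[U] vermaExt a b α β :=
  verma.map _ _ (LinearMap.inr ℂ ℂ W) (inr_algebraMap_end a α) (inr_algebraMap_end b β)

/-- The projection onto the Verma module of the first coordinate. -/
noncomputable def proj (a b : ℂ) (α β : W) : vermaExt a b α β →ₗ[U] vermaC a b :=
  verma.map _ _ (LinearMap.fst ℂ ℂ W) (fst_extEnd a α) (fst_extEnd b β)

variable (a b : ℂ) (α β : W)

lemma incl_injective : Function.Injective (incl a b α β) := by
  rw [injective_iff_map_eq_zero]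
  intro p hp
  apply (verma.equiv _).injective
  ext q
  have := congrArg (fun p => verma.equiv _ p q) hp
  simp only [incl, verma.equiv_map, map_zero, Finsupp.zero_apply] at this
  rw [map_zero, Finsupp.zero_apply]
  exact congrArg Prod.snd this

lemma proj_surjective : Function.Surjective (proj a b α β) := by
  rw [← LinearMap.range_eq_top]
  exact verma.eq_top_of_mon_zero_mem _ fun z => ⟨verma.mon _ 0 0 (z, 0), verma.map_mon ..⟩

lemma range_incl : LinearMap.range (incl a b α β) = LinearMap.ker (proj a b α β) := by
  ext p
  rw [LinearMap.mem_ker]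
  constructor
  · rintro ⟨p, rfl⟩
    apply (verma.equiv _).injective
    ext q
    rw [incl, proj, verma.equiv_map, verma.equiv_map]
    simp
  · intro hp
    refine ⟨(verma.equiv _).symm
      (Finsupp.mapRange.linearMap (LinearMap.snd ℂ ℂ W) (verma.equiv _ p)), ?_⟩
    apply (verma.equiv _).injective
    refine Finsupp.ext fun q => ?_
    rw [incl, verma.equiv_map, LinearEquiv.apply_symm_apply, Finsupp.mapRange.linearMap_apply,
      Finsupp.mapRange_apply]
    have := congrArg (fun p => verma.equiv _ p q) hp
    simp only [proj, verma.equiv_map, map_zero, Finsupp.zero_apply] at this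
    exact Prod.ext this.symm rfl

variable {a b α β}

/-- A map `φ` to `vermaC a b` sends the generator `(1, 0)` to a highest weight vector, on which
`h - a` and `hBar - b` vanish; but they send `(1, 0)` to `α` and `β`. So `φ` kills `α` and `β`, and
with them the submodule induced from `W`. -/
lemma hom_comp_incl (hb : b ≠ 0) (hspan : Submodule.span ℂ {α, β} = ⊤)
    (φ : vermaExt a b α β →ₗ[U] vermaC a b) : φ ∘ₗ incl a b α β = 0 := by
  let ψ : W →ₗ[ℂ] vermaC a b :=
    φ.restrictScalars ℂ ∘ₗ verma.mon _ 0 0 ∘ₗ LinearMap.inr ℂ ℂ W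
  have hsum : ∀ (c : ℂ) (γ : W), extEnd c γ (1, 0) = c • (1, 0) + LinearMap.inr ℂ ℂ W γ := by
    intro c γ
    simp [extEnd_apply]
  obtain ⟨c, hc⟩ := vermaC.exists_eq_vec hb (p := φ (verma.mon _ 0 0 (1, 0)))
    (by rw [← map_smul, verma.e_mon_zero, map_zero])
    (by rw [← map_smul, verma.eBar_mon_zero, map_zero])
  have hα : ψ α = 0 := by
    have h1 : ι h • φ (verma.mon _ 0 0 (1, 0)) =
        a • φ (verma.mon _ 0 0 (1, 0)) + ψ α := by
      rw [← map_smul, verma.h_mon_zero, hsum, map_add, map_smul, map_add]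
      exact congrArg (· + _) (LinearMap.map_smul_of_tower φ a _)
    rw [hc, vermaC.h_vec] at h1
    exact left_eq_add.1 h1
  have hβ : ψ β = 0 := by
    have h1 : ι hBar • φ (verma.mon _ 0 0 (1, 0)) =
        b • φ (verma.mon _ 0 0 (1, 0)) + ψ β := by
      rw [← map_smul, verma.hBar_mon_zero, hsum, map_add, map_smul, map_add]
      exact congrArg (· + _) (LinearMap.map_smul_of_tower φ b _)
    rw [hc, vermaC.hBar_vec] at h1
    exact left_eq_add.1 h1
  have hψ : ψ = 0 := by
    rw [← LinearMap.ker_eq_top, ← top_le_iff, ← hspan, Submodule.span_le]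
    rintro _ (rfl | rfl)
    exacts [hα, hβ]
  refine verma.homU_ext _ fun u => ?_
  rw [LinearMap.comp_apply, incl, verma.map_mon, LinearMap.zero_apply]
  exact LinearMap.congr_fun hψ u

end vermaExt

section Lift

variable {a b : ℂ} {M : ModuleCat.{0} U} {i : vermaC a b →ₗ[U] M} {p : M →ₗ[U] vermaC a b}

/-- In a self-extension `M` of `vermaC a b`, the highest weight vector of the quotient has a
preimage `v` killed by `e` and `eBar`, which `h - a` and `hBar - b` send to multiples of the
highest weight vector of the submodule. -/
lemma exists_almost_highest_weight_vector (hi : Function.Injective i) (hp : Function.Surjective p)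
    (hex : LinearMap.range i = LinearMap.ker p) :
    ∃ (v : M) (s t : ℂ), p v = vermaC.vec a b 1 ∧ ι e • v = 0 ∧ ι eBar • v = 0 ∧
      ι h • v = a • v + i (vermaC.vec a b s) ∧ ι hBar • v = b • v + i (vermaC.vec a b t) := by
  have hker : ∀ w, p w = 0 → ∃ x, i x = w := fun w hw => by
    have : w ∈ LinearMap.range i := hex ▸ hw
    exact this
  have hpi : ∀ x, p (i x) = 0 := fun x => by
    have : i x ∈ LinearMap.ker p := hex ▸ ⟨x, rfl⟩
    exact this
  obtain ⟨v₁, hv₁⟩ := hp (vermaC.vec a b 1)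
  obtain ⟨x, hx⟩ := hker (ι h • v₁ - a • v₁) (by
    rw [map_sub, map_smul, LinearMap.map_smul_of_tower, hv₁, vermaC.h_vec, sub_self])
  obtain ⟨q, s, rfl⟩ := vermaC.exists_sub_eq_vec x
  -- Correcting the preimage by `q` leaves a highest weight vector as the value of `h - a`.
  obtain ⟨v, hv⟩ : ∃ v, v = v₁ - i q := ⟨_, rfl⟩
  have hpv : p v = vermaC.vec a b 1 := by rw [hv, map_sub, hpi, sub_zero, hv₁]
  have hhv : ι h • v = a • v + i (vermaC.vec a b s) := by
    rw [map_add, map_sub, map_smul, LinearMap.map_smul_of_tower] at hx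
    rw [hv, smul_sub, smul_sub, ← sub_eq_zero]
    rw [← sub_eq_zero] at hx
    rw [← neg_eq_zero, ← hx]
    abel
  -- `(hBar - b) v`, `e v` and `eBar v` lie in the submodule; their `h`-weights determine them.
  have hweight : ∀ (w : vermaC a b) (c : ℂ), ι h • i w = c • i w → ι h • w = c • w :=
    fun w c hw => hi (by rw [map_smul, LinearMap.map_smul_of_tower, hw])
  obtain ⟨y, hy⟩ := hker (ι hBar • v - b • v) (by
    rw [map_sub, map_smul, LinearMap.map_smul_of_tower, hpv, vermaC.hBar_vec, sub_self])
  obtain ⟨t, rfl⟩ := vermaC.exists_eq_vec_of_h_smul (p := y) (hweight _ _ (by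
    rw [hy, smul_sub, ← ι_hBar_h, hhv, smul_add, ← map_smul i, vermaC.hBar_vec,
      smul_comm (ι hBar) a, smul_comm (ι h) b, hhv, smul_add, LinearMap.map_smul_of_tower,
      smul_sub, smul_comm b a]
    abel))
  refine ⟨v, s, t, hpv, ?_, ?_, hhv, by rw [hy]; abel⟩
  · obtain ⟨z, hz⟩ := hker (ι e • v) (by rw [map_smul, hpv, verma.e_mon_zero])
    rw [← hz, vermaC.eq_zero_of_h_smul (p := z) (hweight _ _ ?_), map_zero]
    rw [hz, ι_h_e, hhv, smul_add, ← map_smul i, verma.e_mon_zero, map_zero, add_zero,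
      smul_comm (ι e) a, add_smul]
  · obtain ⟨z, hz⟩ := hker (ι eBar • v) (by rw [map_smul, hpv, verma.eBar_mon_zero])
    rw [← hz, vermaC.eq_zero_of_h_smul (p := z) (hweight _ _ ?_), map_zero]
    rw [hz, ι_h_eBar, hhv, smul_add, ← map_smul i, verma.eBar_mon_zero, map_zero, add_zero,
      smul_comm (ι eBar) a, add_smul]

variable {α β : W}

/-- A functional `ρ` with values `s`, `t` at `α`, `β` gives a map from `vermaExt` to an extension of
`vermaC a b` by itself with parameters `s`, `t`, over `vermaC a b`. -/
lemma exists_lift_vermaExt {v : M} {s t : ℂ} (hpi : ∀ x, p (i x) = 0)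
    (hpv : p v = vermaC.vec a b 1) (he : ι e • v = 0) (he' : ι eBar • v = 0)
    (hh : ι h • v = a • v + i (vermaC.vec a b s))
    (hh' : ι hBar • v = b • v + i (vermaC.vec a b t)) {ρ : W →ₗ[ℂ] ℂ} (hα : ρ α = s)
    (hβ : ρ β = t) :
    ∃ l : vermaExt a b α β →ₗ[U] M, p ∘ₗ l = vermaExt.proj a b α β := by
  let θ : ℂ × W →ₗ[ℂ] M := (LinearMap.toSpanSingleton ℂ M v).coprod
    (i.restrictScalars ℂ ∘ₗ vermaC.vec a b ∘ₗ ρ)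
  have hθ : ∀ w, θ w = w.1 • v + i (vermaC.vec a b (ρ w.2)) := fun w => rfl
  have key : ∀ (x : Takiff) (c : ℂ) (γ : W), ι x • v = c • v + i (vermaC.vec a b (ρ γ)) →
      (∀ d, ι x • vermaC.vec a b d = c • vermaC.vec a b d) →
      ∀ w, ι x • θ w = θ (extEnd c γ w) := by
    intro x c γ h1 h2 w
    rw [hθ, hθ, extEnd_apply, smul_add, smul_comm (ι x) w.1, h1, ← map_smul i, h2, map_add ρ,
      map_smul ρ, map_smul ρ, map_add, map_smul (vermaC.vec a b), map_smul (vermaC.vec a b),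
      map_add, LinearMap.map_smul_of_tower, LinearMap.map_smul_of_tower, smul_add,
      smul_smul, mul_comm c]
    abel
  refine ⟨verma.lift _ θ (fun w => ?_) (fun w => ?_) (key h a α (hα ▸ hh) vermaC.h_vec)
    (key hBar b β (hβ ▸ hh') vermaC.hBar_vec), ?_⟩
  · rw [hθ, smul_add, smul_comm, he, smul_zero, ← map_smul, verma.e_mon_zero, map_zero, add_zero]
  · rw [hθ, smul_add, smul_comm, he', smul_zero, ← map_smul, verma.eBar_mon_zero, map_zero,
      add_zero]
  · refine verma.homU_ext _ fun w => ?_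
    rw [LinearMap.comp_apply, verma.lift_mon_zero, hθ, map_add, hpi, add_zero,
      LinearMap.map_smul_of_tower, hpv, vermaExt.proj, verma.map_mon, ← map_smul, smul_eq_mul,
      mul_one, LinearMap.fst_apply]

end Lift

lemma apply_eq_of_iSup_eigenspace_eq_top {V : Type} [AddCommGroup V] [Module ℂ V]
    {T : Module.End ℂ V} (hT : ⨆ c : ℂ, T.eigenspace c = ⊤) {a : ℂ} {v : V}
    (hv : (T - a • 1) ((T - a • 1) v) = 0) : (T - a • 1) v = 0 := by
  have hvT : v ∈ ⨆ c : ℂ, T.eigenspace c := hT ▸ Submodule.mem_top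
  obtain ⟨x, hx, rfl⟩ := (Submodule.mem_iSup_iff_exists_finsupp _ _).1 hvT
  have hx' : ∀ c, (T - a • 1) (x c) = (c - a) • x c := fun c => by
    rw [LinearMap.sub_apply, Module.End.mem_eigenspace_iff.1 (hx c), sub_smul]
    rfl
  have hmem := mem_of_sum_mem T (LinearMap.ker ((T - a • 1) ∘ₗ (T - a • 1))) (fun w hw => by
    have hc : ∀ w, (T - a • 1) (T w) = T ((T - a • 1) w) := fun w => by simp
    rw [LinearMap.mem_ker, LinearMap.comp_apply] at hw ⊢
    rw [hc, hc, hw, map_zero]) x.support x hx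
    (by rw [Finsupp.sum] at hv; exact hv)
  rw [Finsupp.sum, map_sum]
  refine Finset.sum_eq_zero fun c hc => ?_
  have h1 := hmem c hc
  rw [LinearMap.mem_ker, LinearMap.comp_apply, hx', map_smul, hx', smul_smul] at h1
  rw [hx']
  rcases smul_eq_zero.1 h1 with h2 | h2
  · rw [mul_self_eq_zero.1 h2, zero_smul]
  · rw [h2, smul_zero]

/-- In category `O`, the action of `h` in a self-extension is semisimple, which forces `s = 0`. -/
lemma eq_zero_of_catO {a b : ℂ} {M : ModuleCat.{0} U} (hM : catO M) {i : vermaC a b →ₗ[U] M}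
    (hi : Function.Injective i) {v : M} {s : ℂ} (hv : ι h • v = a • v + i (vermaC.vec a b s)) :
    s = 0 := by
  have h1 : (act M h - a • 1) v = i (vermaC.vec a b s) := by
    change ι h • v - a • v = _
    rw [hv, add_sub_cancel_left]
  have h2 : (act M h - a • 1) (i (vermaC.vec a b s)) = 0 := by
    change ι h • i (vermaC.vec a b s) - a • i (vermaC.vec a b s) = 0
    rw [← map_smul, vermaC.h_vec, LinearMap.map_smul_of_tower, sub_self]
  have h3 := apply_eq_of_iSup_eigenspace_eq_top hM.2 (by rw [h1, h2])
  rw [h1] at h3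
  exact vermaC.vec_injective (hi (by rw [h3, map_zero, map_zero]))

end Extension

/-! ### Full subcategories of modules -/

section FullSubcategory

/-- The morphism of a full subcategory of modules given by a linear map. -/
def ofLinearMap {R : Type} [Ring R] {P : ObjectProperty (ModuleCat.{0} R)}
    {M N : P.FullSubcategory} (g : M.obj →ₗ[R] N.obj) : M ⟶ N :=
  P.homMk (ModuleCat.ofHom g)

lemma hom_eq_of_linearMap_eq {R : Type} [Ring R] {P : ObjectProperty (ModuleCat.{0} R)}
    {M N : P.FullSubcategory} {φ ψ : M ⟶ N} (hφ : φ.hom.hom = ψ.hom.hom) : φ = ψ :=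
  P.ι.map_injective (ModuleCat.hom_ext hφ)

lemma mono_iff_injective {R : Type} [Ring R] {P : ObjectProperty (ModuleCat.{0} R)}
    [P.IsClosedUnderSubobjects] [P.ContainsZero] {X Y : P.FullSubcategory} (f : X ⟶ Y) :
    Mono f ↔ Function.Injective f.hom.hom := by
  have := P.preservesMonomorphisms_ι_of_isNormalEpiCategory
  exact (P.ι.mono_map_iff_mono f).symm.trans (ModuleCat.mono_iff_injective _)

lemma simple_iff_isSimpleModule_obj {R : Type} [Ring R] {P : ObjectProperty (ModuleCat.{0} R)}
    [P.IsClosedUnderSubobjects] [P.IsClosedUnderQuotients] [P.ContainsZero]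
    (L : P.FullSubcategory) : Simple L ↔ IsSimpleModule R L.obj := by
  constructor
  · intro hL
    rw [isSimpleModule_iff]
    have hzero : ∀ {X : P.FullSubcategory} (f : X ⟶ L), f = 0 ↔ f.hom.hom = 0 := fun f =>
      ⟨fun h0 => by rw [h0]; rfl, fun h0 => P.ι.map_injective (ModuleCat.hom_ext h0)⟩
    have key : ∀ N : Submodule R L.obj, N ≠ ⊥ → N = ⊤ := by
      intro N hN
      have hm : Mono (ModuleCat.ofHom N.subtype) :=
        (ModuleCat.mono_iff_injective _).2 N.injective_subtype
      have hPN : P (ModuleCat.of R N) := P.prop_of_mono (ModuleCat.ofHom N.subtype) L.property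
      let f : (⟨ModuleCat.of R N, hPN⟩ : P.FullSubcategory) ⟶ L :=
        P.homMk (ModuleCat.ofHom N.subtype)
      have hf : Mono f := (mono_iff_injective f).2 N.injective_subtype
      have hf0 : f ≠ 0 := fun h0 => hN (by
        rw [← N.range_subtype, LinearMap.range_eq_bot]
        exact (hzero f).1 h0)
      have := isIso_of_mono_of_nonzero hf0
      have h1 : Epi (P.ι.map f) := inferInstance
      have h2 : Function.Surjective N.subtype := (ModuleCat.epi_iff_surjective _).1 h1
      rw [← N.range_subtype, LinearMap.range_eq_top]
      exact h2
    have : Nontrivial (Submodule R L.obj) := by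
      by_contra h0
      rw [not_nontrivial_iff_subsingleton, Submodule.subsingleton_iff] at h0
      exact id_nonzero L ((hzero _).2 (LinearMap.ext fun x => Subsingleton.elim _ _))
    exact { eq_bot_or_eq_top := fun N => or_iff_not_imp_left.2 (key N) }
  · intro hL
    have hL' : Simple (P.ι.obj L) := simple_iff_isSimpleModule.2 hL
    refine ⟨fun {Y} f hf => ⟨fun h1 h0 => ?_, fun h0 => ?_⟩⟩
    · have : Epi (P.ι.map f) := inferInstance
      rw [h0, P.ι.map_zero] at this
      exact id_nonzero (P.ι.obj L) ((cancel_epi (0 : P.ι.obj Y ⟶ P.ι.obj L)).1 (by simp))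
    · have hm : Mono (P.ι.map f) := (ModuleCat.mono_iff_injective _).2 ((mono_iff_injective f).1 hf)
      have : IsIso (P.ι.map f) := isIso_of_mono_of_nonzero (f := P.ι.map f) fun h1 =>
        h0 (P.ι.map_injective (h1.trans (P.ι.map_zero _ _).symm))
      exact isIso_of_reflects_iso f P.ι

lemma shortExact_iff {R : Type} [Ring R] {P : ObjectProperty (ModuleCat.{0} R)}
    [P.IsClosedUnderSubobjects] [P.IsClosedUnderQuotients] [P.ContainsZero]
    [P.IsClosedUnderFiniteProducts] (S : ShortComplex P.FullSubcategory) : S.ShortExact ↔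
    Function.Injective S.f.hom.hom ∧ Function.Surjective S.g.hom.hom ∧
      LinearMap.range S.f.hom.hom = LinearMap.ker S.g.hom.hom := by
  have : ∀ {X Y : P.FullSubcategory} (f : X ⟶ Y), PreservesLimit (parallelPair f 0) P.ι :=
    fun f => P.preservesKernels_ι f
  have : ∀ {X Y : P.FullSubcategory} (f : X ⟶ Y), PreservesColimit (parallelPair f 0) P.ι :=
    fun f => P.preservesCokernels_ι f
  have := P.ι.preservesFiniteLimits_of_preservesKernels
  have := P.ι.preservesFiniteColimits_of_preservesCokernels
  rw [← ShortExact.shortExact_map_iff P.ι]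
  constructor
  · intro hS
    exact ⟨hS.moduleCat_injective_f, hS.moduleCat_surjective_g, hS.exact.moduleCat_range_eq_ker⟩
  · rintro ⟨h1, h2, h3⟩
    exact { exact := (ShortComplex.moduleCat_exact_iff_range_eq_ker _).2 h3
            mono_f := (ModuleCat.mono_iff_injective _).2 h1
            epi_g := (ModuleCat.epi_iff_surjective _).2 h2 }

end FullSubcategory

/-! ### The Gabriel quiver of a block -/

section Quiver

variable {n : ℕ} {a b : ℂ}

lemma map_algebraMap_end {W W' : Type} [AddCommGroup W] [Module ℂ W] [AddCommGroup W']
    [Module ℂ W'] (g : W →ₗ[ℂ] W') (c : ℂ) (w : W) :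
    g (algebraMap ℂ (Module.End ℂ W) c w) = algebraMap ℂ (Module.End ℂ W') c (g w) :=
  map_smul g c w

/-- The map induced by `g` on Verma modules of the same scalar weight. -/
noncomputable def verma.mapScalar {W W' : Type} [AddCommGroup W] [Module ℂ W] [AddCommGroup W']
    [Module ℂ W'] (a b : ℂ) (g : W →ₗ[ℂ] W') :
    verma (commute_algebraMap_end W a b) →ₗ[U] verma (commute_algebraMap_end W' a b) :=
  verma.map _ _ g (map_algebraMap_end g a) (map_algebraMap_end g b)

lemma verma.equiv_mapScalar {W W' : Type} [AddCommGroup W] [Module ℂ W] [AddCommGroup W']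
    [Module ℂ W'] (g : W →ₗ[ℂ] W') (p : verma (commute_algebraMap_end W a b)) (q : ℕ × ℕ) :
    equiv _ (mapScalar a b g p) q = g (equiv _ p q) :=
  equiv_map ..

lemma ClosedProp.verma_algebraMap {P : ObjectProperty (ModuleCat.{0} U)} (hP : ClosedProp P)
    (hL : P (vermaC a b)) :
    P (verma (commute_algebraMap_end (Fin n → ℂ) a b)) := by
  let g : Fin n → verma (commute_algebraMap_end (Fin n → ℂ) a b) →ₗ[U] vermaC a b := fun k =>
    verma.mapScalar a b (LinearMap.proj k)
  refine hP.inj (LinearMap.pi g : _ →ₗ[U] ModuleCat.of U (Fin n → vermaC a b)) ?_ (hP.pi hL n)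
  rw [injective_iff_map_eq_zero]
  intro p hp
  apply (verma.equiv _).injective
  ext q k
  have h1 : g k p = 0 := congrFun hp k
  have h2 := congrArg (fun p => verma.equiv _ p q) h1
  simp only [g, verma.equiv_mapScalar, map_zero, Finsupp.zero_apply] at h2
  rw [map_zero, Finsupp.zero_apply]
  exact h2

/-- A map from the Verma module induced from `ℂⁿ` to `vermaC a b` is a functional on `ℂⁿ`,
because it takes values in highest weight vectors on degree zero. -/
lemma nonempty_linearEquiv_hom (hb : b ≠ 0) {P : ObjectProperty (ModuleCat.{0} U)}
    (hK : P (verma (commute_algebraMap_end (Fin n → ℂ) a b))) (hL : P (vermaC a b)) :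
    Nonempty ((Fin n → ℂ) ≃ₗ[ℂ] ((⟨_, hK⟩ : P.FullSubcategory) ⟶ ⟨_, hL⟩)) := by
  let T : ((⟨_, hK⟩ : P.FullSubcategory) ⟶ ⟨_, hL⟩) →ₗ[ℂ] (Fin n → ℂ) :=
    { toFun := fun φ k => vermaC.eqv a b (φ.hom.hom
        (verma.mon (commute_algebraMap_end (Fin n → ℂ) a b) 0 0 (Pi.single k 1))) (0, 0)
      map_add' := fun φ ψ => rfl
      map_smul' := fun c φ => funext fun k => by
        change vermaC.eqv a b (c • φ.hom.hom
          (verma.mon (commute_algebraMap_end (Fin n → ℂ) a b) 0 0 (Pi.single k 1))) (0, 0) = _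
        rw [map_smul]
        rfl }
  refine ⟨(LinearEquiv.ofBijective T ⟨?_, fun c => ?_⟩).symm⟩
  · rw [injective_iff_map_eq_zero]
    intro φ hφ
    have h1 : ∀ k, φ.hom.hom (verma.mon _ 0 0 (Pi.single k 1)) = 0 := fun k => by
      obtain ⟨c, hc⟩ := vermaC.exists_eq_vec hb
        (p := φ.hom.hom (verma.mon _ 0 0 (Pi.single k 1)))
        (by rw [← map_smul, verma.e_mon_zero, map_zero])
        (by rw [← map_smul, verma.eBar_mon_zero, map_zero])
      have h2 : vermaC.eqv a b (φ.hom.hom (verma.mon _ 0 0 (Pi.single k 1))) (0, 0) = 0 :=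
        congrFun hφ k
      rw [hc, verma.equiv_mon, Finsupp.single_eq_same] at h2
      rw [hc, h2, map_zero]
    have h3 : φ.hom.hom.restrictScalars ℂ ∘ₗ verma.mon _ 0 0 = 0 :=
      LinearMap.pi_ext' fun k => LinearMap.ext_ring (h1 k)
    have h4 : φ.hom.hom = 0 := verma.homU_ext _ fun v => LinearMap.congr_fun h3 v
    exact hom_eq_of_linearMap_eq h4
  · let g : (Fin n → ℂ) →ₗ[ℂ] ℂ := Fintype.linearCombination ℂ c
    refine ⟨ofLinearMap (P := P) (M := ⟨_, hK⟩) (N := ⟨_, hL⟩) (verma.mapScalar a b g),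
      funext fun k => ?_⟩
    change vermaC.eqv a b (verma.mapScalar a b g (verma.mon _ 0 0 (Pi.single k 1))) (0, 0) = c k
    rw [verma.equiv_mapScalar, verma.equiv_mon, Finsupp.single_eq_same]
    simp [g, Fintype.linearCombination_apply_single]

variable {X : ObjectProperty (ModuleCat.{0} U)} {μ : Weight}

/-- The Gabriel quiver of a block for which `vermaExt` is a universal self-extension: it belongs to
`X`, and every pair `(s, t)` of parameters of a self-extension in `X` is the image of `(α, β)` under
some functional `ρ`. -/
theorem nonempty_quiverIso [(block X μ).IsClosedUnderSubobjects]
    [(block X μ).IsClosedUnderQuotients] [(block X μ).ContainsZero]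
    [(block X μ).IsClosedUnderFiniteProducts] (hX : ClosedProp X) (hμ : μ cartanHBar ≠ 0)
    {α β : Fin n → ℂ} (hspan : Submodule.span ℂ {α, β} = ⊤)
    (hL : X (vermaC (μ cartanH) (μ cartanHBar)))
    (hP : X (vermaExt (μ cartanH) (μ cartanHBar) α β))
    (hρ : ∀ {M : ModuleCat.{0} U} (i : vermaC (μ cartanH) (μ cartanHBar) →ₗ[U] M) (v : M)
      (s t : ℂ), X M → Function.Injective i → ι h • v = μ cartanH • v + i (vermaC.vec _ _ s) →
        ∃ ρ : (Fin n → ℂ) →ₗ[ℂ] ℂ, ρ α = s ∧ ρ β = t) :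
    Nonempty (QuiverIso (GabrielQuiver (block X μ).FullSubcategory) (LoopQuiver n)) := by
  have hLs : SimpleSupport μ (vermaC (μ cartanH) (μ cartanHBar)) := SimpleSupport.vermaC hμ
  have hL' : block X μ (vermaC (μ cartanH) (μ cartanHBar)) := ⟨hL, hLs⟩
  have hK' : block X μ (verma (commute_algebraMap_end (Fin n → ℂ) (μ cartanH) (μ cartanHBar))) :=
    (hX.block μ).verma_algebraMap hL'
  have hP' : block X μ (vermaExt (μ cartanH) (μ cartanHBar) α β) :=
    ⟨hP, SimpleSupport.of_exact hK'.2 hLs (vermaExt.incl _ _ _ _) (vermaExt.proj _ _ _ _)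
      (vermaExt.range_incl _ _ _ _).ge⟩
  let L : (block X μ).FullSubcategory := ⟨_, hL'⟩
  let K : (block X μ).FullSubcategory := ⟨_, hK'⟩
  let E : (block X μ).FullSubcategory := ⟨_, hP'⟩
  let i : K ⟶ E := ofLinearMap (vermaExt.incl _ _ _ _)
  let p : E ⟶ L := ofLinearMap (vermaExt.proj _ _ _ _)
  have hrange := vermaExt.range_incl (μ cartanH) (μ cartanHBar) α β
  have hip : i ≫ p = 0 := hom_eq_of_linearMap_eq (LinearMap.range_le_ker_iff.1 hrange.le)
  have hS : (ShortComplex.mk i p hip).ShortExact := (shortExact_iff _).2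
    ⟨vermaExt.incl_injective _ _ _ _, vermaExt.proj_surjective _ _ _ _, hrange⟩
  have hsimple : IsSimpleModule U L.obj := vermaC.isSimpleModule hμ
  refine GabrielQuiver.nonempty_quiverIso_loopQuiver n L
    ((simple_iff_isSimpleModule_obj L).2 hsimple) (fun S hS' => ?_) ?_
  · have hS'' := (simple_iff_isSimpleModule_obj S).1 hS'
    obtain ⟨g⟩ := nonempty_vermaC_equiv hμ hS'' (S.property.2 S.obj
      ⟨⊤, Submodule.topEquiv.toLinearMap, Submodule.topEquiv.surjective⟩
      (simple_iff_isSimpleModule.2 hS''))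
    exact ⟨(block X μ).isoMk g.toModuleIso⟩
  · have : HasExt.{1} (block X μ).FullSubcategory := HasExt.standard _
    obtain ⟨ψ⟩ := nonempty_linearEquiv_hom hμ hK' hL'
    obtain ⟨δ⟩ := Abelian.Ext.nonempty_hom_linearEquiv (k := ℂ) hS (Y := L) (fun φ =>
      hom_eq_of_linearMap_eq (vermaExt.hom_comp_incl hμ hspan φ.hom.hom))
      (fun {M} j q hjq hM => by
        obtain ⟨hj, hq, hjq'⟩ := (shortExact_iff _).1 hM
        obtain ⟨v, s, t, hqv, he, he', hh, hh'⟩ :=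
          exists_almost_highest_weight_vector hj hq hjq'
        obtain ⟨ρ, hs, ht⟩ := hρ j.hom.hom v s t M.property.1 hj hh
        obtain ⟨l, hl⟩ := exists_lift_vermaExt
          (fun x => LinearMap.congr_fun (LinearMap.range_le_ker_iff.1 hjq'.le) x)
          hqv he he' hh hh' hs ht
        exact ⟨ofLinearMap l, hom_eq_of_linearMap_eq hl⟩)
    exact ⟨ψ ≪≫ₗ δ⟩

end Quiver

end Takiff

theorem corollary16 (μ : Takiff.Weight) (hμ : μ Takiff.cartanHBar ≠ 0) :
    Nonempty (QuiverIso (GabrielQuiver (Takiff.BlockO μ)) (LoopQuiver 1)) ∧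
    Nonempty (QuiverIso (GabrielQuiver (Takiff.BlockThickO μ)) (LoopQuiver 2)) := by
  constructor
  -- In category `O` only `hBar - b` can be nonzero, and one parameter is left.
  · have hP := Takiff.catO_closed.block μ
    have := hP.sub
    have := hP.quot
    have := hP.containsZero
    have := hP.finiteProducts
    refine Takiff.nonempty_quiverIso Takiff.catO_closed hμ (α := 0) (β := fun _ => 1) ?_
      (Takiff.verma.catO _ fun v => Module.algebraMap_end_apply ..)
      (Takiff.verma.catO _ (a := μ Takiff.cartanH) fun v => ?_) fun i v s t hM hi hv => ?_
    · rw [eq_top_iff]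
      intro v _
      exact Submodule.mem_span_pair.2 ⟨0, v 0, by ext k; simp [Subsingleton.elim k 0]⟩
    · rw [Takiff.extEnd_apply, smul_zero, add_zero]
      rfl
    · exact ⟨t • LinearMap.proj 0, by simp [Takiff.eq_zero_of_catO hM hi hv], by simp⟩
  -- In the thick category the values of `h - a` and `hBar - b` are independent.
  · have hP := Takiff.thickO_closed.block μ
    have := hP.sub
    have := hP.quot
    have := hP.containsZero
    have := hP.finiteProducts
    refine Takiff.nonempty_quiverIso Takiff.thickO_closed hμ (α := Pi.single 0 1)
      (β := Pi.single 1 1) ?_ (Takiff.verma.thickO _) (Takiff.verma.thickO _)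
      fun i v s t hM hi hv => ?_
    · rw [eq_top_iff]
      intro v _
      exact Submodule.mem_span_pair.2 ⟨v 0, v 1, by ext k; fin_cases k <;> simp⟩
    · exact ⟨s • LinearMap.proj 0 + t • LinearMap.proj 1, by simp, by simp⟩
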